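/- Let $(\Omega,\mathcal F_\infty,\mathbb P)$ be a probability space with a discrete-time filtration $(\mathcal F_t)_{t\ge 0}$, $t\in\{0,1,2,\dots\}$, and let $P=(P_t)_{t\ge 0}$ be an adapted $\mathbb R^n$-valued process (the prices of $n$ assets; no sign condition is imposed and no numéraire is assumed). A \emph{martingale deflator} is an almost surely strictly positive adapted real process $Y=(Y_t)_{t\ge 0}$ such that $(P_tY_t)_{t\ge 0}$ is an $n$-dimensional martingale. An \emph{investment-consumption strategy} is an $\mathbb R^n$-valued predictable process $H=(H_t)_{t\ge 1}$ ($H_t$ is $\mathcal F_{t-1}$-measurable) such that $H_t\cdot P_t\ge H_{t+1}\cdot P_t$ almost surely for all $t\ge 1$. \textbf{Theorem.} Suppose there exists at least one martingale deflator. Let $\xi=(\xi_t)_{t\ge 0}$ be an adapted real process such that $\xi Y$ is a supermartingale for every martingale deflator $Y$ for which $\xi_tY_t$ is integrable for all $t\ge 0$. Then there exists an investment-consumption strategy $H$ such that, almost surely, $$H_1\cdot P_0\le \xi_0 \qquad\text{and}\qquad H_{t+1}\cdot P_t\le \xi_t\le H_t\cdot P_t\quad\text{for all } t\ge 1.$$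 -/

import Mathlib

open MeasureTheory

/-- A martingale deflator for the `n`-dimensional price process `P`: an adapted, almost surely
strictly positive process `Y` such that `P Y` is an `n`-dimensional martingale. -/
structure IsMartingaleDeflator {Ω : Type*} {mΩ : MeasurableSpace Ω} {n : ℕ}
    (ℙ : Measure Ω) (ℱ : Filtration ℕ mΩ) (P : ℕ → Ω → EuclideanSpace ℝ (Fin n))
    (Y : ℕ → Ω → ℝ) : Prop where
  adapted : Adapted ℱ Y
  pos : ∀ t, ∀ᵐ ω ∂ℙ, 0 < Y t ω
  martingale : Martingale (fun t ω => Y t ω • P t ω) ℱ ℙ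

/-- An investment-consumption strategy: a predictable `n`-dimensional process `(H t)`, `t ≥ 1`,
with `H t · P t ≥ H (t + 1) · P t` almost surely for all `t ≥ 1`.
The portfolio `H t` is held over the interval `(t - 1, t]`; the value `H 0` plays no role
(for a predictable process on `ℕ` it is only asked to be measurable at time `0`). -/
structure IsInvestmentConsumptionStrategy {Ω : Type*} {mΩ : MeasurableSpace Ω} {n : ℕ}
    (ℙ : Measure Ω) (ℱ : Filtration ℕ mΩ) (P : ℕ → Ω → EuclideanSpace ℝ (Fin n))
    (H : ℕ → Ω → EuclideanSpace ℝ (Fin n)) : Prop where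
  predictable : IsStronglyPredictable ℱ H
  selfFinancing : ∀ t, 1 ≤ t →
    ∀ᵐ ω ∂ℙ, inner ℝ (H (t + 1) ω) (P t ω) ≤ inner ℝ (H t ω) (P t ω)

/-! The problem splits into single periods. If $h_t$ is $\mathcal F_t$-measurable with $h_t\cdot
P_t\le\xi_t$ and $\xi_{t+1}\le h_t\cdot P_{t+1}$, then $H_{t+1}=h_t$ works: the self-financing
inequality holds because $\xi_t$ separates the values of consecutive portfolios.

Fix a deflator $Z$ making every $\xi_tZ_t$ integrable, and write $p=Z_{t+1}P_{t+1}$,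
$x=Z_{t+1}\xi_{t+1}$, $m=Z_tP_t=E[p\mid\mathcal F_t]$, $x_0=Z_t\xi_t$. A bounded positive $\theta$
with $E[\theta p\mid\mathcal F_t]=m$ can be spliced into $Z$ to give another deflator, so the
hypothesis yields $E[\theta x\mid\mathcal F_t]\le x_0$. The hedge comes from a variational argument:
minimise $L(h\cdot m-x_0)+E[L(x-h\cdot p)]$ for the softplus $L$, with derivative the sigmoid
$\sigma$. Since $m$ is the mean of $p$, this is coercive modulo directions orthogonal to $p$. The
first-order condition (`exists_sigmoid_pricing`) says that $\theta=\sigma(x-h\cdot p)/\sigma(h\cdot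
m-x_0)$ preserves the mean. Applying the price bound to this $\theta$, after scaling $x,x_0$ by
$k+1$, leaves shortfalls of order $1/(k+1)$; compactness gives an exact hedge
(`exists_superhedge_of_sigmoid_le`). Conditional laws and measurable selection make the hedge
$\mathcal F_t$-measurable (`exists_superhedge_of_condExp_le`).

To obtain $Z$, integrability at one time $s$ is reached by backward induction: a change of density
over the last period (`exists_perturbation_same_condExp`) dominates the variable by an $\mathcal
F_{s-1}$-measurable one. All times are treated by a decreasing sequence of densities with summable
deviations, whose limit is positive by Borel–Cantelli. -/

/-! ### Measurable selection. -/

open Filter Topology in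
/-- A random closed set given as a sublevel set of a Carathéodory function admits a measurable
selection. -/
theorem exists_measurable_selection_sublevel {β X : Type*} [MeasurableSpace β] [MetricSpace X]
    [ProperSpace X] [Nonempty X] [MeasurableSpace X] [BorelSpace X] (f : β → X → ℝ)
    (hm : ∀ x, Measurable fun b => f b x) (hc : ∀ b, Continuous (f b)) :
    ∃ h : β → X, Measurable h ∧ ∀ b, (∃ x, f b x ≤ 0) → f b (h b) ≤ 0 := by
  classical
  let q := TopologicalSpace.denseSeq X
  have hq : DenseRange q := TopologicalSpace.denseRange_denseSeq X
  let T : β → X → ℝ → Prop := fun b x r => ∃ c, f b c ≤ 0 ∧ dist c x ≤ r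
  -- Closed balls are compact, so near-solutions with tolerance tending to zero subconverge to a
  -- solution. Being close to the sublevel set thus becomes a countable condition on the dense
  -- sequence, hence measurable in `b`.
  have hTiff : ∀ b x r, T b x r ↔ ∀ k : ℕ, ∃ j, dist (q j) x < r + 1 / ((k : ℝ) + 1) ∧
      f b (q j) < 1 / ((k : ℝ) + 1) := by
    intro b x r
    constructor
    · rintro ⟨c, hc0, hcr⟩ k
      have hk : (0 : ℝ) < 1 / ((k : ℝ) + 1) := Nat.one_div_pos_of_nat
      have ho : IsOpen {y | dist y x < r + 1 / ((k : ℝ) + 1) ∧ f b y < 1 / ((k : ℝ) + 1)} :=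
        IsOpen.and (isOpen_lt (continuous_id.dist continuous_const) continuous_const)
          (isOpen_lt (hc b) continuous_const)
      obtain ⟨j, hj⟩ := hq.exists_mem_open ho ⟨c, by linarith, by linarith⟩
      exact ⟨j, hj⟩
    · intro h
      choose j hj1 hj2 using h
      have hmem : ∀ k, q (j k) ∈ Metric.closedBall x (r + 1) := by
        intro k
        have h1 : 1 / ((k : ℝ) + 1) ≤ 1 := by
          rw [div_le_one (by positivity)]
          linarith [Nat.cast_nonneg (α := ℝ) k]
        rw [Metric.mem_closedBall]
        linarith [hj1 k]
      obtain ⟨c, -, φ, hφ, hlim⟩ := (isCompact_closedBall x (r + 1)).tendsto_subseq hmem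
      have h0 : Tendsto (fun k => 1 / ((φ k : ℝ) + 1)) atTop (𝓝 0) :=
        tendsto_one_div_add_atTop_nhds_zero_nat.comp hφ.tendsto_atTop
      refine ⟨c, ?_, ?_⟩
      · exact le_of_tendsto_of_tendsto' ((hc b).tendsto c |>.comp hlim) h0
          fun k => (hj2 (φ k)).le
      · have h1 : Tendsto (fun k => r + 1 / ((φ k : ℝ) + 1)) atTop (𝓝 r) := by
          simpa using h0.const_add r
        exact le_of_tendsto_of_tendsto' (hlim.dist tendsto_const_nhds) h1
          fun k => (hj1 (φ k)).le
  have hTm : ∀ x r, MeasurableSet {b | T b x r} := by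
    intro x r
    simp only [hTiff, Set.ofPred_forall, Set.ofPred_exists]
    refine MeasurableSet.iInter fun k => MeasurableSet.iUnion fun j => ?_
    exact (MeasurableSet.const _).inter (measurableSet_lt (hm _) measurable_const)
  let S : β → Prop := fun b => ∃ x, f b x ≤ 0
  have hSm : MeasurableSet {b | S b} := by
    have : {b | S b} = ⋃ N : ℕ, {b | T b (q 0) N} := by
      ext b
      simp only [Set.mem_iUnion, Set.mem_ofPred_eq]
      constructor
      · rintro ⟨x, hx⟩
        obtain ⟨N, hN⟩ := exists_nat_ge (dist x (q 0))
        exact ⟨N, x, hx, hN⟩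
      · rintro ⟨N, x, hx, -⟩
        exact ⟨x, hx⟩
    rw [this]
    exact MeasurableSet.iUnion fun N => hTm _ _
  let A : ℕ → Type _ := fun k =>
    {J : β → ℕ // Measurable J ∧ ∀ b, S b → T b (q (J b)) ((1 / 2 : ℝ) ^ k)}
  have happrox : ∀ (c : X) (r : ℝ), 0 < r → ∃ j, dist c (q j) ≤ r := by
    intro c r hr
    obtain ⟨j, hj⟩ := hq.exists_dist_lt c hr
    exact ⟨j, hj.le⟩
  have base : Nonempty (A 0) := by
    have hex : ∀ b, ∃ j, ¬ S b ∨ T b (q j) 1 := by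
      intro b
      by_cases hS : S b
      · obtain ⟨x, hx⟩ := hS
        obtain ⟨j, hj⟩ := happrox x 1 one_pos
        exact ⟨j, Or.inr ⟨x, hx, hj⟩⟩
      · exact ⟨0, Or.inl hS⟩
    refine ⟨fun b => Nat.find (hex b), measurable_find hex fun j => ?_, fun b hb => ?_⟩
    · exact hSm.compl.union (hTm _ _)
    · have := Nat.find_spec (hex b)
      simpa [hb] using this
  -- Both successive points are compared with the same `c` in the sublevel set, at distances
  -- $2^{-k}$ and $2^{-k-1}$. The geometric bound makes the choices Cauchy, and the limit lies in
  -- the closed sublevel set.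
  have step : ∀ k (J : A k), ∃ J' : A (k + 1),
      ∀ b, S b → dist (q (J.1 b)) (q (J'.1 b)) ≤ 2 * (1 / 2 : ℝ) ^ k := by
    intro k J
    have hex : ∀ b, ∃ j, ¬ S b ∨
        (T b (q j) ((1 / 2 : ℝ) ^ (k + 1)) ∧ dist (q (J.1 b)) (q j) ≤ 2 * (1 / 2 : ℝ) ^ k) := by
      intro b
      by_cases hS : S b
      · obtain ⟨c, hc0, hcd⟩ := J.2.2 b hS
        obtain ⟨j, hj⟩ := happrox c ((1 / 2 : ℝ) ^ (k + 1)) (by positivity)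
        refine ⟨j, Or.inr ⟨⟨c, hc0, hj⟩, ?_⟩⟩
        have h1 := dist_triangle (q (J.1 b)) c (q j)
        rw [dist_comm _ c] at h1
        have h2 : (1 / 2 : ℝ) ^ (k + 1) ≤ (1 / 2 : ℝ) ^ k :=
          pow_le_pow_of_le_one (by norm_num) (by norm_num) (Nat.le_succ k)
        linarith
      · exact ⟨0, Or.inl hS⟩
    refine ⟨⟨fun b => Nat.find (hex b), measurable_find hex fun j => ?_, fun b hb => ?_⟩,
      fun b hb => ?_⟩
    · refine hSm.compl.union ((hTm _ _).inter ?_)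
      exact measurableSet_le
        ((measurable_from_nat (f := fun i => dist (q i) (q j))).comp J.2.1) measurable_const
    · have := Nat.find_spec (hex b)
      rcases this with h | h
      · exact absurd hb h
      · exact h.1
    · have := Nat.find_spec (hex b)
      rcases this with h | h
      · exact absurd hb h
      · exact h.2
  choose next hnext using step
  let J : ∀ k, A k := fun k => Nat.rec base.some (fun k J => next k J) k
  have hJ : ∀ k b, S b → dist (q ((J k).1 b)) (q ((J (k + 1)).1 b)) ≤ 2 * (1 / 2 : ℝ) ^ k :=
    fun k b hb => hnext k (J k) b hb
  let u : ℕ → β → X := fun k b => if S b then q ((J k).1 b) else q 0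
  have hum : ∀ k, Measurable (u k) := fun k =>
    Measurable.ite hSm (measurable_from_nat.comp (J k).2.1) measurable_const
  have hlim : ∀ b, ∃ x, Tendsto (fun k => u k b) atTop (𝓝 x) := by
    intro b
    refine cauchySeq_tendsto_of_complete (cauchySeq_of_le_geometric (1 / 2) 2 (by norm_num) ?_)
    intro k
    by_cases hb : S b
    · simpa only [u, hb, if_true] using hJ k b hb
    · simp only [u, hb, if_false, dist_self]
      positivity
  choose h hh using hlim
  refine ⟨h, measurable_of_tendsto_metrizable hum (tendsto_pi_nhds.2 hh), fun b hb => ?_⟩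
  have hT : ∀ k, T b (u k b) ((1 / 2 : ℝ) ^ k) := by
    intro k
    have := (J k).2.2 b hb
    simp only [u]
    rwa [if_pos hb]
  choose c hc0 hcd using hT
  have hc1 : Tendsto c atTop (𝓝 (h b)) := by
    have h0 : Tendsto (fun k => dist (u k b) (c k)) atTop (𝓝 0) :=
      squeeze_zero (fun _ => dist_nonneg) (fun k => by rw [dist_comm]; exact hcd k)
        (tendsto_pow_atTop_nhds_zero_of_lt_one (by norm_num) (by norm_num))
    exact (tendsto_iff_of_dist h0).1 (hh b)
  exact le_of_tendsto' ((hc b).tendsto _ |>.comp hc1) hc0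

/-! ### Coercivity and barycentre corrections for an integrable random vector. -/

section FiniteDimensional

variable {S E : Type*} [MeasurableSpace S] {κ : Measure S}
  [NormedAddCommGroup E] [InnerProductSpace ℝ E]

lemma integrable_lipschitz_sub_inner [IsFiniteMeasure κ] {L : ℝ → ℝ} (hL : LipschitzWith 1 L)
    {p : S → E} {x : S → ℝ} (hp : Integrable p κ) (hx : Integrable x κ) (h : E) :
    Integrable (fun s => L (x s - inner ℝ h (p s))) κ := by
  have hi : Integrable (fun s => x s - inner ℝ h (p s)) κ := hx.sub (hp.const_inner h)
  refine ((integrable_const ‖L 0‖).add hi.norm).mono'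
    (hL.continuous.comp_aestronglyMeasurable hi.aestronglyMeasurable) (.of_forall fun s => ?_)
  have h1 := hL.dist_le_mul (x s - inner ℝ h (p s)) 0
  simp only [NNReal.coe_one, one_mul, dist_zero_right] at h1
  have h2 := norm_le_norm_add_norm_sub (L 0) (L (x s - inner ℝ h (p s)))
  rw [dist_eq_norm] at h1
  simp only [Pi.add_apply]
  rw [norm_sub_rev] at h2
  linarith

lemma continuous_integral_lipschitz_sub_inner [IsFiniteMeasure κ] {L : ℝ → ℝ}
    (hL : LipschitzWith 1 L) {p : S → E} {x : S → ℝ} (hp : Integrable p κ) (hx : Integrable x κ) :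
    Continuous fun h : E => ∫ s, L (x s - inner ℝ h (p s)) ∂κ := by
  refine (LipschitzWith.of_dist_le_mul (K := (∫ s, ‖p s‖ ∂κ).toNNReal) fun h h' => ?_).continuous
  rw [Real.coe_toNNReal _ (integral_nonneg fun _ => norm_nonneg _), dist_eq_norm,
    ← integral_sub (integrable_lipschitz_sub_inner hL hp hx h)
      (integrable_lipschitz_sub_inner hL hp hx h'), ← integral_mul_const]
  refine norm_integral_le_of_norm_le (hp.norm.mul_const _) (.of_forall fun s => ?_)
  have h1 := hL.dist_le_mul (x s - inner ℝ h (p s)) (x s - inner ℝ h' (p s))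
  rw [NNReal.coe_one, one_mul, dist_eq_norm] at h1
  refine h1.trans ?_
  rw [dist_eq_norm, show x s - inner ℝ h (p s) - (x s - inner ℝ h' (p s))
    = inner ℝ (h' - h) (p s) by rw [inner_sub_left]; ring, dist_comm h, dist_eq_norm, mul_comm]
  exact norm_inner_le_norm _ _

/-- The directions almost surely orthogonal to the random vector `p`. -/
def nullDirections (κ : Measure S) (p : S → E) : Submodule ℝ E where
  carrier := {v | ∀ᵐ s ∂κ, inner ℝ v (p s) = 0}
  add_mem' {v w} hv hw := by
    change ∀ᵐ s ∂κ, _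
    filter_upwards [hv, hw] with s h1 h2
    rw [inner_add_left, h1, h2, add_zero]
  zero_mem' := by simp
  smul_mem' c v hv := by
    change ∀ᵐ s ∂κ, _
    filter_upwards [hv] with s h1
    rw [real_inner_smul_left, h1, mul_zero]

lemma mem_nullDirections {p : S → E} {v : E} :
    v ∈ nullDirections κ p ↔ ∀ᵐ s ∂κ, inner ℝ v (p s) = 0 := Iff.rfl

/-- The factor $(1+\|v\|)^{-1}$ turns a linear functional into one bounded by $\|l\|$, so a
correction with small `l` cannot destroy the positivity of a weight. -/
lemma abs_inv_one_add_norm_mul_inner_le (l v : E) : |(1 + ‖v‖)⁻¹ * inner ℝ l v| ≤ ‖l‖ := by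
  have h0 : 0 < 1 + ‖v‖ := by positivity
  rw [abs_mul, abs_inv, abs_of_pos h0, inv_mul_le_iff₀ h0]
  calc |inner ℝ l v| ≤ ‖l‖ * ‖v‖ := abs_real_inner_le_norm _ _
    _ ≤ (1 + ‖v‖) * ‖l‖ := by nlinarith [norm_nonneg l]

lemma integrable_bounded_weight_correction {p : S → E} (hp : Integrable p κ)
    {w : S → ℝ} (hw : AEStronglyMeasurable w κ) (hw0 : ∀ s, 0 < w s) (hw1 : ∀ s, w s ≤ 1) (l : E) :
    Integrable (fun s => (w s * ((1 + ‖p s‖)⁻¹ * inner ℝ l (p s))) • p s) κ := by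
  have h2 : AEStronglyMeasurable (fun s => (1 + ‖p s‖)⁻¹) κ :=
    Continuous.comp_aestronglyMeasurable (g := fun v : E => (1 + ‖v‖)⁻¹)
      (Continuous.inv₀ (by fun_prop) fun v => by positivity) hp.aestronglyMeasurable
  refine Integrable.bdd_smul hp ‖l‖ (hw.mul (h2.mul (hp.const_inner l).aestronglyMeasurable))
    (.of_forall fun s => ?_)
  rw [norm_mul, Real.norm_of_nonneg (hw0 s).le]
  exact (mul_le_of_le_one_left (norm_nonneg _) (hw1 s)).trans
    (abs_inv_one_add_norm_mul_inner_le l (p s))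

variable [FiniteDimensional ℝ E]

/-- Redundant components of a portfolio do not affect its payoff. Removing them restores compactness
without any nondegeneracy of `p`. -/
lemma exists_orthogonal_nullDirections_ae_eq (κ : Measure S) (p : S → E) (h : E) :
    ∃ h' ∈ (nullDirections κ p)ᗮ, h - h' ∈ nullDirections κ p ∧
      ∀ᵐ s ∂κ, inner ℝ h' (p s) = inner ℝ h (p s) := by
  have h1 : h - (h - (nullDirections κ p).starProjection h) ∈ nullDirections κ p := by
    rw [sub_sub_cancel]
    exact Submodule.starProjection_apply_mem _ _
  refine ⟨h - (nullDirections κ p).starProjection h,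
    Submodule.sub_starProjection_mem_orthogonal h, h1, ?_⟩
  filter_upwards [mem_nullDirections.1 h1] with s hs
  rw [inner_sub_left] at hs
  linarith

/-- The integral is continuous in `v` and vanishes only on null directions, so it has a positive
minimum on the compact unit sphere of their orthogonal complement. -/
lemma exists_mul_norm_le_integral_abs_inner [IsFiniteMeasure κ] {p : S → E}
    (hp : Integrable p κ) :
    ∃ c > 0, ∀ v ∈ (nullDirections κ p)ᗮ, c * ‖v‖ ≤ ∫ s, |inner ℝ v (p s)| ∂κ := by
  have hL : LipschitzWith 1 (fun t : ℝ => |t|) :=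
    LipschitzWith.of_dist_le_mul fun a b => by
      simpa [Real.dist_eq] using abs_abs_sub_abs_le_abs_sub a b
  have hcont : Continuous fun v : E => ∫ s, |inner ℝ v (p s)| ∂κ := by
    simpa using continuous_integral_lipschitz_sub_inner (κ := κ) hL hp
      (integrable_zero S ℝ κ)
  have hK : IsCompact (Metric.sphere (0 : E) 1 ∩ ((nullDirections κ p)ᗮ : Set E)) :=
    (isCompact_sphere _ _).inter_right (Submodule.closed_of_finiteDimensional _)
  rcases (Metric.sphere (0 : E) 1 ∩ ((nullDirections κ p)ᗮ : Set E)).eq_empty_or_nonempty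
    with he | hne
  · refine ⟨1, one_pos, fun v hv => ?_⟩
    by_cases hv0 : v = 0
    · simp [hv0]
    · exfalso
      have : (‖v‖⁻¹ • v) ∈ Metric.sphere (0 : E) 1 ∩ ((nullDirections κ p)ᗮ : Set E) := by
        refine ⟨?_, Submodule.smul_mem _ _ hv⟩
        simp [norm_smul, hv0]
      simp [he] at this
  · obtain ⟨v₀, ⟨hv₀, hv₀'⟩, hmin⟩ := hK.exists_isMinOn hne hcont.continuousOn
    have hnn : 0 ≤ ∫ s, |inner ℝ v₀ (p s)| ∂κ := integral_nonneg fun _ => abs_nonneg _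
    refine ⟨∫ s, |inner ℝ v₀ (p s)| ∂κ, lt_of_le_of_ne hnn fun h0 => ?_, fun v hv => ?_⟩
    · have h1 := (integral_eq_zero_iff_of_nonneg (fun _ => abs_nonneg _)
        (hp.const_inner v₀).abs).1 h0.symm
      have h2 : v₀ ∈ nullDirections κ p := by
        rw [mem_nullDirections]
        filter_upwards [h1] with s hs
        simpa using hs
      have h3 := Submodule.inner_right_of_mem_orthogonal h2 hv₀'
      rw [real_inner_self_eq_norm_sq] at h3
      have h4 : ‖v₀‖ = 1 := by simpa using hv₀
      norm_num [h4] at h3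
    · by_cases hv0 : v = 0
      · simp [hv0]
      · have hvp : 0 < ‖v‖ := norm_pos_iff.2 hv0
        have h1 : (‖v‖⁻¹ • v) ∈ Metric.sphere (0 : E) 1 ∩ ((nullDirections κ p)ᗮ : Set E) := by
          refine ⟨?_, Submodule.smul_mem _ _ hv⟩
          simp [norm_smul, hv0]
        have h2 : ∫ s, |inner ℝ v₀ (p s)| ∂κ ≤ ∫ s, |inner ℝ (‖v‖⁻¹ • v) (p s)| ∂κ := hmin h1
        simp only [real_inner_smul_left, abs_mul, abs_inv, abs_norm] at h2
        rw [integral_const_mul, ← div_eq_inv_mul, le_div_iff₀ hvp] at h2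
        exact h2

/-- The map from `l` to the integral is a weighted Gram operator of `p`: symmetric, with kernel the
null directions. Its range is therefore their orthogonal complement, on which it is injective, and
finite dimension gives the linear bound on `l`. -/
lemma exists_bounded_weight_correction [IsFiniteMeasure κ] {p : S → E} (hp : Integrable p κ)
    {w : S → ℝ} (hw : AEStronglyMeasurable w κ) (hw0 : ∀ s, 0 < w s) (hw1 : ∀ s, w s ≤ 1) :
    ∃ C > 0, ∀ e ∈ (nullDirections κ p)ᗮ, ∃ l : E, ‖l‖ ≤ C * ‖e‖ ∧
      ∫ s, (w s * ((1 + ‖p s‖)⁻¹ * inner ℝ l (p s))) • p s ∂κ = e := by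
  have hint := integrable_bounded_weight_correction hp hw hw0 hw1
  let A : E →ₗ[ℝ] E :=
    { toFun := fun l => ∫ s, (w s * ((1 + ‖p s‖)⁻¹ * inner ℝ l (p s))) • p s ∂κ
      map_add' := fun l m => by
        rw [← integral_add (hint l) (hint m)]
        congr 1 with s
        rw [← add_smul, inner_add_left]
        ring_nf
      map_smul' := fun c l => by
        rw [RingHom.id_apply, ← integral_smul]
        congr 1 with s
        rw [smul_smul, real_inner_smul_left]
        ring_nf }
  have hA : ∀ l m, inner ℝ (A l) m =
      ∫ s, w s * ((1 + ‖p s‖)⁻¹ * (inner ℝ l (p s) * inner ℝ m (p s))) ∂κ := by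
    intro l m
    rw [real_inner_comm]
    change inner ℝ m (∫ s, (w s * ((1 + ‖p s‖)⁻¹ * inner ℝ l (p s))) • p s ∂κ) = _
    rw [← integral_inner (hint l)]
    congr 1 with s
    rw [real_inner_smul_right]
    ring
  have hsymm : A.IsSymmetric := by
    intro l m
    rw [hA, real_inner_comm, hA]
    congr 1 with s
    ring
  have hker : A.ker = nullDirections κ p := by
    ext l
    rw [LinearMap.mem_ker, mem_nullDirections]
    constructor
    · intro h
      have h1 := hA l l
      rw [h, inner_zero_left] at h1
      have hi : Integrable
          (fun s => w s * ((1 + ‖p s‖)⁻¹ * (inner ℝ l (p s) * inner ℝ l (p s)))) κ := by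
        refine ((hint l).const_inner l).congr (.of_forall fun s => ?_)
        simp only [real_inner_smul_right]
        ring
      have h2 := (integral_eq_zero_iff_of_nonneg (fun s => mul_nonneg (hw0 s).le
        (mul_nonneg (by positivity) (mul_self_nonneg _))) hi).1 h1.symm
      filter_upwards [h2] with s hs
      have h3 : (1 + ‖p s‖)⁻¹ ≠ 0 := by positivity
      simpa [(hw0 s).ne', h3] using hs
    · intro h
      change ∫ s, (w s * ((1 + ‖p s‖)⁻¹ * inner ℝ l (p s))) • p s ∂κ = 0
      refine integral_eq_zero_of_ae ?_
      filter_upwards [h] with s hs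
      simp [hs]
  have hrange : A.range = (nullDirections κ p)ᗮ := by
    rw [← hker, ← hsymm.orthogonal_range, Submodule.orthogonal_orthogonal]
  let B : (nullDirections κ p)ᗮ →ₗ[ℝ] E := A.domRestrict (nullDirections κ p)ᗮ
  have hB : B.ker = ⊥ := by
    rw [LinearMap.ker_eq_bot']
    rintro ⟨m, hm⟩ hm0
    have h1 : m ∈ A.ker := hm0
    rw [hker] at h1
    have h2 := Submodule.inner_right_of_mem_orthogonal h1 hm
    ext
    simpa using h2
  obtain ⟨K, hK, hKB⟩ := B.exists_antilipschitzWith hB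
  refine ⟨K, hK, fun e he => ?_⟩
  rw [← hrange] at he
  obtain ⟨l₀, hl₀⟩ := he
  obtain ⟨l, hl, hl', -⟩ := exists_orthogonal_nullDirections_ae_eq κ p l₀
  have hl1 : A l = e := by
    rw [← hker, LinearMap.mem_ker, map_sub, sub_eq_zero] at hl'
    rw [← hl', hl₀]
  refine ⟨l, ?_, hl1⟩
  have h2 := hKB.le_mul_dist ⟨l, hl⟩ 0
  rw [map_zero, dist_zero_right, dist_zero_right] at h2
  rw [← hl1]
  exact h2

open Filter Topology in
/-- The truncations `(1 + |g| / (N + 1))⁻¹` can be corrected by small multiples of bounded functions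
of `p` so that the barycentre of `p` is preserved. -/
lemma exists_truncation_with_same_barycentre [IsFiniteMeasure κ] {p : S → E}
    (hp : Integrable p κ) {g : S → ℝ} (hg : AEStronglyMeasurable g κ) {ε : ℝ} (hε : 0 < ε)
    (N₀ : ℕ) :
    ∃ l : E, ∃ N : ℕ, N₀ ≤ N ∧ ‖l‖ ≤ ε ∧
      ∫ s, ((1 + |g s| / ((N : ℝ) + 1))⁻¹
        + (1 + |g s|)⁻¹ * ((1 + ‖p s‖)⁻¹ * inner ℝ l (p s))) • p s ∂κ = ∫ s, p s ∂κ := by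
  have hφm : ∀ N : ℕ, AEStronglyMeasurable (fun s => (1 + |g s| / ((N : ℝ) + 1))⁻¹) κ := fun N =>
    Continuous.comp_aestronglyMeasurable (g := fun t : ℝ => (1 + |t| / ((N : ℝ) + 1))⁻¹)
      (Continuous.inv₀ (by fun_prop) fun v => by positivity) hg
  have hφ0 : ∀ (N : ℕ) s, 0 < (1 + |g s| / ((N : ℝ) + 1))⁻¹ := fun N s => by positivity
  have hφ1 : ∀ (N : ℕ) s, (1 + |g s| / ((N : ℝ) + 1))⁻¹ ≤ 1 := fun N s =>
    inv_le_one_of_one_le₀ (by linarith [show 0 ≤ |g s| / ((N : ℝ) + 1) by positivity])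
  have hφi : ∀ N : ℕ, Integrable (fun s => (1 + |g s| / ((N : ℝ) + 1))⁻¹ • p s) κ := fun N =>
    Integrable.bdd_smul hp 1 (hφm N) (.of_forall fun s => by
      rw [Real.norm_of_nonneg (hφ0 N s).le]; exact hφ1 N s)
  -- The weight $(1+|g|)^{-1}$ is the truncation with $N=0$. It lies below every other truncation,
  -- so a small correction with this weight is a small fraction of the truncation it corrects.
  have hwm : AEStronglyMeasurable (fun s => (1 + |g s|)⁻¹) κ := by simpa using hφm 0
  obtain ⟨C, hC, hsol⟩ := exists_bounded_weight_correction hp hwm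
    (fun s => by simpa using hφ0 0 s) (fun s => by simpa using hφ1 0 s)
  have hlim : Tendsto (fun N : ℕ => ∫ s, (1 + |g s| / ((N : ℝ) + 1))⁻¹ • p s ∂κ) atTop
      (𝓝 (∫ s, p s ∂κ)) := by
    refine tendsto_integral_of_dominated_convergence (fun s => ‖p s‖)
      (fun N => (hφi N).aestronglyMeasurable) hp.norm (fun N => .of_forall fun s => ?_)
      (.of_forall fun s => ?_)
    · rw [norm_smul, Real.norm_of_nonneg (hφ0 N s).le]
      exact mul_le_of_le_one_left (norm_nonneg _) (hφ1 N s)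
    · have h1 : Tendsto (fun N : ℕ => (1 + |g s| * (1 / ((N : ℝ) + 1)))⁻¹) atTop
          (𝓝 (1 + |g s| * 0)⁻¹) :=
        ((tendsto_one_div_add_atTop_nhds_zero_nat.const_mul _).const_add _).inv₀ (by simp)
      simp only [mul_zero, add_zero, inv_one, mul_one_div] at h1
      simpa using h1.smul_const (p s)
  have hlim' : Tendsto (fun N : ℕ => C * ‖∫ s, p s ∂κ -
      ∫ s, (1 + |g s| / ((N : ℝ) + 1))⁻¹ • p s ∂κ‖) atTop (𝓝 0) := by
    simpa using ((hlim.const_sub (∫ s, p s ∂κ)).norm.const_mul C)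
  obtain ⟨N, hN, hN₀⟩ := ((hlim'.eventually_le_const hε).and (eventually_ge_atTop N₀)).exists
  have horth : (∫ s, p s ∂κ - ∫ s, (1 + |g s| / ((N : ℝ) + 1))⁻¹ • p s ∂κ)
      ∈ (nullDirections κ p)ᗮ := by
    rw [← integral_sub hp (hφi N), Submodule.mem_orthogonal]
    intro v hv
    refine (integral_inner (𝕜 := ℝ) (hp.sub (hφi N)) v).symm.trans ?_
    refine integral_eq_zero_of_ae ?_
    filter_upwards [mem_nullDirections.1 hv] with s hs
    simp [inner_sub_right, real_inner_smul_right, hs]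
  obtain ⟨l, hl, hl'⟩ := hsol _ horth
  refine ⟨l, N, hN₀, hl.trans hN, ?_⟩
  simp only [add_smul]
  rw [integral_add (hφi N) (integrable_bounded_weight_correction hp hwm
    (fun s => by simpa using hφ0 0 s) (fun s => by simpa using hφ1 0 s) l), hl']
  abel

end FiniteDimensional

/-! ### The softplus loss and its derivative, the sigmoid. -/

section Softplus

lemma hasDerivAt_log_one_add_exp (t : ℝ) :
    HasDerivAt (fun t => Real.log (1 + Real.exp t)) (Real.sigmoid t) t := by
  have h1 : HasDerivAt (fun t => 1 + Real.exp t) (Real.exp t) t :=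
    (Real.hasDerivAt_exp t).const_add 1
  convert h1.log (by positivity) using 1
  rw [Real.sigmoid_def, Real.exp_neg]
  field_simp
  ring

lemma lipschitzWith_log_one_add_exp :
    LipschitzWith 1 (fun t : ℝ => Real.log (1 + Real.exp t)) := by
  refine lipschitzWith_of_nnnorm_deriv_le
    (fun t => (hasDerivAt_log_one_add_exp t).differentiableAt) fun t => ?_
  rw [(hasDerivAt_log_one_add_exp t).deriv, ← NNReal.coe_le_coe, coe_nnnorm,
    Real.norm_of_nonneg (Real.sigmoid_nonneg t)]
  exact Real.sigmoid_le_one t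

lemma max_zero_le_log_one_add_exp (t : ℝ) : max t 0 ≤ Real.log (1 + Real.exp t) := by
  have := Real.exp_pos t
  refine max_le ?_ (Real.log_nonneg (by linarith))
  rw [Real.le_log_iff_exp_le (by linarith)]
  linarith

/-- For $t\ge0$ the sigmoid is at least $1/2$; for $t\le0$ the bound $e^{-t}\ge1-t$ gives
$t\sigma(t)\ge-1$. The additive loss of 1 becomes negligible after scaling. -/
lemma half_max_zero_sub_one_le_mul_sigmoid (t : ℝ) :
    max t 0 / 2 - 1 ≤ t * Real.sigmoid t := by
  rcases le_total 0 t with ht | ht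
  · rw [max_eq_left ht]
    have h1 : 2⁻¹ ≤ Real.sigmoid t := by
      rw [← Real.sigmoid_zero]
      exact Real.sigmoid_monotone ht
    nlinarith
  · rw [max_eq_right ht, Real.sigmoid_def, ← div_eq_mul_inv, le_div_iff₀ (by positivity)]
    linarith [Real.add_one_le_exp (-t)]

lemma lipschitzWith_max_zero : LipschitzWith 1 (fun t : ℝ => max t 0) :=
  LipschitzWith.id.max_const 0

end Softplus

/-! ### One-period superhedging duality. -/

section OnePeriod

variable {S E : Type*} [MeasurableSpace S] {κ : Measure S}
  [NormedAddCommGroup E] [InnerProductSpace ℝ E] [FiniteDimensional ℝ E]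
  {p : S → E} {x : S → ℝ}

lemma inner_integral_eq_of_ae_eq (hp : Integrable p κ) {h h' : E}
    (hh : ∀ᵐ s ∂κ, inner ℝ h' (p s) = inner ℝ h (p s)) :
    inner ℝ h' (∫ s, p s ∂κ) = inner ℝ h (∫ s, p s ∂κ) := by
  rw [← integral_inner hp, ← integral_inner hp]
  exact integral_congr_ae hh

/-- Integrate $|h\cdot p|\le h\cdot p+2((x-h\cdot p)^++|x|)$ and use that the mean of $h\cdot p$ is
at most $x_0$ plus the excess cost. Portfolios with bounded gap are thus bounded modulo null
directions. -/
lemma exists_mul_norm_le_superhedging_gap [IsFiniteMeasure κ] (hp : Integrable p κ) (hx : Integrable x κ) :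
    ∃ c > 0, ∀ x₀ : ℝ, ∀ h ∈ (nullDirections κ p)ᗮ, c * ‖h‖ ≤
      2 * (max (inner ℝ h (∫ s, p s ∂κ) - x₀) 0 + ∫ s, max (x s - inner ℝ h (p s)) 0 ∂κ)
        + (|x₀| + 2 * ∫ s, |x s| ∂κ) := by
  obtain ⟨c, hc, hcv⟩ := exists_mul_norm_le_integral_abs_inner hp
  refine ⟨c, hc, fun x₀ h hh => (hcv h hh).trans ?_⟩
  have hi := integrable_lipschitz_sub_inner lipschitzWith_max_zero hp hx h
  have h1 : ∫ s, |inner ℝ h (p s)| ∂κ ≤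
      ∫ s, (inner ℝ h (p s) + 2 * (max (x s - inner ℝ h (p s)) 0 + |x s|)) ∂κ := by
    refine integral_mono (hp.const_inner h).abs
      ((hp.const_inner h).add ((hi.add hx.abs).const_mul 2)) fun s => ?_
    have h2 := le_max_left (x s - inner ℝ h (p s)) 0
    have h3 := le_max_right (x s - inner ℝ h (p s)) 0
    have h4 := abs_nonneg (x s)
    have h5 := neg_abs_le (x s)
    exact abs_le'.2 ⟨by linarith, by linarith⟩
  have h10 := integral_add (hp.const_inner h) ((hi.add hx.abs).const_mul 2)
  simp only [Pi.add_apply] at h10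
  rw [h10, integral_const_mul, integral_add hi hx.abs, integral_inner hp] at h1
  have h6 := le_max_left (inner ℝ h (∫ s, p s ∂κ) - x₀) 0
  have h7 := le_max_right (inner ℝ h (∫ s, p s ∂κ) - x₀) 0
  have h8 := le_abs_self x₀
  linarith

/-- First-order condition for the minimiser of a smooth penalty of the superhedging gap. -/
theorem exists_sigmoid_pricing [IsFiniteMeasure κ] (hp : Integrable p κ) (hx : Integrable x κ) (x₀ : ℝ) :
    ∃ h : E, Real.sigmoid (inner ℝ h (∫ s, p s ∂κ) - x₀) • ∫ s, p s ∂κ =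
      ∫ s, Real.sigmoid (x s - inner ℝ h (p s)) • p s ∂κ := by
  let L : ℝ → ℝ := fun t => Real.log (1 + Real.exp t)
  have hL : LipschitzWith 1 L := lipschitzWith_log_one_add_exp
  let f : E → ℝ := fun h => L (inner ℝ h (∫ s, p s ∂κ) - x₀) + ∫ s, L (x s - inner ℝ h (p s)) ∂κ
  have hfc : Continuous f := by
    refine (hL.continuous.comp (by fun_prop)).add
      (continuous_integral_lipschitz_sub_inner hL hp hx)
  have hLi := integrable_lipschitz_sub_inner hL hp hx
  have hMi := integrable_lipschitz_sub_inner lipschitzWith_max_zero hp hx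
  obtain ⟨c, hc, hcv⟩ := exists_mul_norm_le_superhedging_gap hp hx
  have hlow : ∀ h ∈ (nullDirections κ p)ᗮ,
      c * ‖h‖ ≤ 2 * f h + (|x₀| + 2 * ∫ s, |x s| ∂κ) := by
    intro h hh
    have h1 := max_zero_le_log_one_add_exp (inner ℝ h (∫ s, p s ∂κ) - x₀)
    have h2 : ∫ s, max (x s - inner ℝ h (p s)) 0 ∂κ ≤ ∫ s, L (x s - inner ℝ h (p s)) ∂κ :=
      integral_mono (hMi h) (hLi h) fun s => max_zero_le_log_one_add_exp _
    have h3 := hcv x₀ h hh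
    have h4 : f h = Real.log (1 + Real.exp (inner ℝ h (∫ s, p s ∂κ) - x₀)) +
      ∫ s, L (x s - inner ℝ h (p s)) ∂κ := rfl
    linarith
  obtain ⟨R, hR, hR0⟩ : ∃ R : ℝ, 2 * f 0 + (|x₀| + 2 * ∫ s, |x s| ∂κ) ≤ c * R ∧ 0 ≤ R := by
    refine ⟨|(2 * f 0 + (|x₀| + 2 * ∫ s, |x s| ∂κ)) / c|, ?_, abs_nonneg _⟩
    have := le_abs_self ((2 * f 0 + (|x₀| + 2 * ∫ s, |x s| ∂κ)) / c)
    rwa [div_le_iff₀' hc] at this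
  have hK : IsCompact (Metric.closedBall (0 : E) R) := isCompact_closedBall _ _
  obtain ⟨h, -, hmin⟩ := hK.exists_isMinOn ⟨0, by simpa using hR0⟩ hfc.continuousOn
  -- The loss depends only on the component orthogonal to the null directions. If that component
  -- leaves the ball, coercivity and the choice of `R` make the loss exceed `f 0`.
  have hglob : ∀ k, f h ≤ f k := by
    intro k
    obtain ⟨k', hk', -, hkk⟩ := exists_orthogonal_nullDirections_ae_eq κ p k
    have h1 : f k' = f k := by
      have h2 : ∫ s, L (x s - inner ℝ k' (p s)) ∂κ = ∫ s, L (x s - inner ℝ k (p s)) ∂κ := by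
        refine integral_congr_ae ?_
        filter_upwards [hkk] with s hs
        rw [hs]
      simp only [f]
      rw [h2, inner_integral_eq_of_ae_eq hp hkk]
    rw [← h1]
    by_cases hk : ‖k'‖ ≤ R
    · exact hmin (by simpa using hk)
    · have h2 : f h ≤ f 0 := hmin (by simpa using hR0)
      have h3 := hlow k' hk'
      have h4 := mul_lt_mul_of_pos_left (not_le.1 hk) hc
      linarith
  refine ⟨h, ?_⟩
  have hsm : AEStronglyMeasurable (fun s => Real.sigmoid (x s - inner ℝ h (p s))) κ :=
    continuous_sigmoid.comp_aestronglyMeasurable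
      (hx.sub (hp.const_inner h)).aestronglyMeasurable
  have hsi : Integrable (fun s => Real.sigmoid (x s - inner ℝ h (p s)) • p s) κ :=
    Integrable.bdd_smul hp 1 hsm (.of_forall fun s => by
      rw [Real.norm_of_nonneg (Real.sigmoid_nonneg _)]; exact Real.sigmoid_le_one _)
  refine ext_inner_left ℝ fun v => ?_
  -- Stationarity is tested along each line $h+tv$; the integral is differentiated under domination
  -- by $|v\cdot p|$.
  have hd1 : HasDerivAt (fun t : ℝ => L (inner ℝ (h + t • v) (∫ s, p s ∂κ) - x₀))
      (Real.sigmoid (inner ℝ h (∫ s, p s ∂κ) - x₀) * inner ℝ v (∫ s, p s ∂κ)) 0 := by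
    have h1 : HasDerivAt (fun t : ℝ => inner ℝ (h + t • v) (∫ s, p s ∂κ) - x₀)
        (inner ℝ v (∫ s, p s ∂κ)) 0 := by
      simp only [inner_add_left, real_inner_smul_left]
      simpa using (((hasDerivAt_id (0 : ℝ)).mul_const
        (inner ℝ v (∫ s, p s ∂κ))).const_add (inner ℝ h (∫ s, p s ∂κ))).sub_const x₀
    have h2 := (hasDerivAt_log_one_add_exp (inner ℝ (h + (0 : ℝ) • v) (∫ s, p s ∂κ) - x₀)).comp
      (0 : ℝ) h1
    simp only [zero_smul, add_zero] at h2
    exact h2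
  have hd2 : HasDerivAt (fun t : ℝ => ∫ s, L (x s - inner ℝ (h + t • v) (p s)) ∂κ)
      (∫ s, Real.sigmoid (x s - inner ℝ h (p s)) * (- inner ℝ v (p s)) ∂κ) 0 := by
    have h0 := hasDerivAt_integral_of_dominated_loc_of_deriv_le (μ := κ) (s := Set.univ)
      (x₀ := (0 : ℝ)) (F := fun (t : ℝ) s => L (x s - inner ℝ (h + t • v) (p s)))
      (F' := fun t s => Real.sigmoid (x s - inner ℝ (h + t • v) (p s)) * (- inner ℝ v (p s)))
      (bound := fun s => ‖inner ℝ v (p s)‖) Filter.univ_mem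
      (.of_forall fun t => (hLi _).aestronglyMeasurable) (hLi _) ?_ ?_
      (hp.const_inner v).norm ?_
    · simpa using h0.2
    · simp only [zero_smul, add_zero]
      exact hsm.mul (hp.const_inner v).neg.aestronglyMeasurable
    · refine .of_forall fun s t _ => ?_
      rw [norm_mul, norm_neg, Real.norm_of_nonneg (Real.sigmoid_nonneg _)]
      exact mul_le_of_le_one_left (norm_nonneg _) (Real.sigmoid_le_one _)
    · refine .of_forall fun s t _ => ?_
      have h1 : HasDerivAt (fun t : ℝ => x s - inner ℝ (h + t • v) (p s))
          (- inner ℝ v (p s)) t := by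
        simp only [inner_add_left, real_inner_smul_left]
        simpa using (((hasDerivAt_id t).mul_const
          (inner ℝ v (p s))).const_add (inner ℝ h (p s))).const_sub (x s)
      exact (hasDerivAt_log_one_add_exp _).comp t h1
  have hd := hd1.add hd2
  have hloc : IsLocalMin ((fun t : ℝ => L (inner ℝ (h + t • v) (∫ s, p s ∂κ) - x₀)) +
      fun t : ℝ => ∫ s, L (x s - inner ℝ (h + t • v) (p s)) ∂κ) 0 := by
    refine .of_forall fun t => ?_
    have := hglob (h + t • v)
    simpa [f] using this
  have h0 := hloc.hasDerivAt_eq_zero hd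
  rw [real_inner_smul_right, ← integral_inner hsi]
  simp only [real_inner_smul_right]
  simp only [mul_neg, integral_neg] at h0
  linarith

open Filter Topology in
/-- If all the smooth penalty problems have nonpositive cost, there is an exact superhedge. -/
theorem exists_superhedge_of_sigmoid_le [IsProbabilityMeasure κ] (hp : Integrable p κ)
    (hx : Integrable x κ) (x₀ : ℝ)
    (H : ∀ k : ℕ, ∃ h : E,
      (inner ℝ h (∫ s, p s ∂κ) - ((k : ℝ) + 1) * x₀) *
          Real.sigmoid (inner ℝ h (∫ s, p s ∂κ) - ((k : ℝ) + 1) * x₀) +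
        ∫ s, (((k : ℝ) + 1) * x s - inner ℝ h (p s)) *
          Real.sigmoid (((k : ℝ) + 1) * x s - inner ℝ h (p s)) ∂κ ≤ 0) :
    ∃ h : E, inner ℝ h (∫ s, p s ∂κ) ≤ x₀ ∧ ∀ᵐ s ∂κ, x s ≤ inner ℝ h (p s) := by
  let q : E → ℝ := fun h => max (inner ℝ h (∫ s, p s ∂κ) - x₀) 0 +
    ∫ s, max (x s - inner ℝ h (p s)) 0 ∂κ
  have hqc : Continuous q :=
    (lipschitzWith_max_zero.continuous.comp
      (by fun_prop : Continuous fun h : E => inner ℝ h (∫ s, p s ∂κ) - x₀)).add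
      (continuous_integral_lipschitz_sub_inner lipschitzWith_max_zero hp hx)
  have hMi := integrable_lipschitz_sub_inner lipschitzWith_max_zero hp hx
  -- Bounding both terms of the cost below by $t^+/2-1$ gives a total of positive parts at most 4,
  -- as `κ` has mass one. Dividing the portfolio by $k+1$ divides this bound too.
  have key : ∀ k : ℕ, ∃ h ∈ (nullDirections κ p)ᗮ, q h ≤ 4 * (1 / ((k : ℝ) + 1)) := by
    intro k
    obtain ⟨h, hh⟩ := H k
    have hk : (0 : ℝ) < (k : ℝ) + 1 := by positivity
    obtain ⟨h', hh', -, hae⟩ :=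
      exists_orthogonal_nullDirections_ae_eq κ p (((k : ℝ) + 1)⁻¹ • h)
    refine ⟨h', hh', ?_⟩
    have h1 : q h' = q (((k : ℝ) + 1)⁻¹ • h) := by
      have h2 : ∫ s, max (x s - inner ℝ h' (p s)) 0 ∂κ =
          ∫ s, max (x s - inner ℝ (((k : ℝ) + 1)⁻¹ • h) (p s)) 0 ∂κ := by
        refine integral_congr_ae ?_
        filter_upwards [hae] with s hs
        rw [hs]
      simp only [q]
      rw [h2, inner_integral_eq_of_ae_eq hp hae]
    have hscale : ∀ a b : ℝ, max (b - ((k : ℝ) + 1)⁻¹ * a) 0 =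
        ((k : ℝ) + 1)⁻¹ * max (((k : ℝ) + 1) * b - a) 0 := by
      intro a b
      rw [mul_max_of_nonneg _ _ (by positivity), mul_zero]
      congr 1
      field_simp
    have hscale' : ∀ a b : ℝ, max (((k : ℝ) + 1)⁻¹ * a - b) 0 =
        ((k : ℝ) + 1)⁻¹ * max (a - ((k : ℝ) + 1) * b) 0 := by
      intro a b
      rw [mul_max_of_nonneg _ _ (by positivity), mul_zero]
      congr 1
      field_simp
    have hMk := integrable_lipschitz_sub_inner lipschitzWith_max_zero hp
      (hx.const_mul ((k : ℝ) + 1)) h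
    have hbi : Integrable (fun s => (((k : ℝ) + 1) * x s - inner ℝ h (p s)) *
          Real.sigmoid (((k : ℝ) + 1) * x s - inner ℝ h (p s))) κ := by
      have hb : Integrable (fun s => ((k : ℝ) + 1) * x s - inner ℝ h (p s)) κ :=
        (hx.const_mul _).sub (hp.const_inner h)
      refine hb.mul_bdd (c := 1) (continuous_sigmoid.comp_aestronglyMeasurable
        hb.aestronglyMeasurable) (.of_forall fun s => ?_)
      rw [Real.norm_of_nonneg (Real.sigmoid_nonneg _)]
      exact Real.sigmoid_le_one _
    have h3 : ∫ s, (max (((k : ℝ) + 1) * x s - inner ℝ h (p s)) 0 / 2 - 1) ∂κ ≤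
        ∫ s, (((k : ℝ) + 1) * x s - inner ℝ h (p s)) *
          Real.sigmoid (((k : ℝ) + 1) * x s - inner ℝ h (p s)) ∂κ :=
      integral_mono ((hMk.div_const 2).sub (integrable_const 1)) hbi
        fun s => half_max_zero_sub_one_le_mul_sigmoid _
    rw [integral_sub (hMk.div_const 2) (integrable_const 1), integral_div] at h3
    simp only [integral_const, probReal_univ, smul_eq_mul, mul_one] at h3
    have h4 := half_max_zero_sub_one_le_mul_sigmoid
      (inner ℝ h (∫ s, p s ∂κ) - ((k : ℝ) + 1) * x₀)
    rw [h1]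
    simp only [q, real_inner_smul_left, hscale, hscale', integral_const_mul]
    rw [← mul_add, mul_comm, one_div]
    exact mul_le_mul_of_nonneg_right (by linarith) (by positivity)
  choose u hu hqu using key
  obtain ⟨c, hc, hcv⟩ := exists_mul_norm_le_superhedging_gap hp hx
  have hbd : ∀ k, u k ∈ Metric.closedBall (0 : E)
      ((8 + (|x₀| + 2 * ∫ s, |x s| ∂κ)) / c) := by
    intro k
    rw [mem_closedBall_zero_iff, le_div_iff₀' hc]
    have h1 := hcv x₀ (u k) (hu k)
    have h2 := hqu k
    have h3 : 1 / ((k : ℝ) + 1) ≤ 1 := by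
      rw [div_le_one (by positivity)]
      linarith [Nat.cast_nonneg (α := ℝ) k]
    simp only [q] at h2
    linarith
  obtain ⟨h, -, φ, hφ, hlim⟩ := (isCompact_closedBall _ _).tendsto_subseq hbd
  have hq0 : q h ≤ 0 := by
    have h0 : Tendsto (fun k => 4 * (1 / ((φ k : ℝ) + 1))) atTop (𝓝 0) := by
      simpa using
        (tendsto_one_div_add_atTop_nhds_zero_nat.comp hφ.tendsto_atTop).const_mul (4 : ℝ)
    exact le_of_tendsto_of_tendsto' ((hqc.tendsto h).comp hlim) h0 fun k => hqu (φ k)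
  have hn1 : 0 ≤ max (inner ℝ h (∫ s, p s ∂κ) - x₀) 0 := le_max_right _ _
  have hn2 : 0 ≤ ∫ s, max (x s - inner ℝ h (p s)) 0 ∂κ :=
    integral_nonneg fun s => le_max_right _ _
  simp only [q] at hq0
  refine ⟨h, ?_, ?_⟩
  · have := le_max_left (inner ℝ h (∫ s, p s ∂κ) - x₀) 0
    linarith
  · have h0 : ∫ s, max (x s - inner ℝ h (p s)) 0 ∂κ = 0 := le_antisymm (by linarith) hn2
    have h1 := (integral_eq_zero_iff_of_nonneg (fun s => le_max_right _ _) (hMi h)).1 h0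
    filter_upwards [h1] with s hs
    have := le_max_left (x s - inner ℝ h (p s)) 0
    simp only [Pi.zero_apply] at hs
    linarith

end OnePeriod

/-! ### Conditional superhedging through regular conditional distributions. -/

section Conditional

open ProbabilityTheory

variable {Ω β S : Type*} {mΩ : MeasurableSpace Ω} {mβ : MeasurableSpace β}
  {μ : Measure Ω} [IsFiniteMeasure μ] {X : Ω → β}

/-- A version of the conditional distribution of `W` given `X` for which a given integrable function
of `W` is integrable for every value of the conditioning variable. -/
lemma exists_condDistrib_forall_integrable [MeasurableSpace S] [StandardBorelSpace S] [Nonempty S]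
    {F : Type*} [NormedAddCommGroup F] (hX : Measurable X) {W : Ω → S} (hW : Measurable W)
    {w : S → F} (hw : StronglyMeasurable w) (hwW : Integrable (fun ω => w (W ω)) μ) :
    ∃ κ : Kernel β S, IsMarkovKernel κ ∧ (∀ b, Integrable w (κ b)) ∧
      κ =ᵐ[μ.map X] condDistrib W X μ := by
  classical
  let κ₀ := condDistrib W X μ
  have hs : MeasurableSet {b | ∫⁻ y, ‖w y‖ₑ ∂κ₀ b < ⊤} :=
    measurableSet_lt (Measurable.lintegral_kernel hw.enorm) measurable_const
  -- A Dirac mass replaces the law wherever the moment is infinite. Integrability at every `b`, not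
  -- just almost every one, is what makes the selection functions continuous throughout.
  refine ⟨Kernel.piecewise hs κ₀ (Kernel.const β (Measure.dirac (Classical.arbitrary S))),
    inferInstance, fun b => ?_, ?_⟩
  · rw [Kernel.piecewise_apply]
    split_ifs with hb
    · exact ⟨hw.aestronglyMeasurable, hb⟩
    · rw [Kernel.const_apply]
      exact ⟨hw.aestronglyMeasurable, by
        rw [HasFiniteIntegral, lintegral_dirac' _ hw.enorm]; exact enorm_lt_top⟩
  · have hi : Integrable (fun z : β × S => w z.2) (μ.map fun ω => (X ω, W ω)) := by
      exact (integrable_map_measure (hw.comp_measurable measurable_snd).aestronglyMeasurable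
        (hX.prodMk hW).aemeasurable).2 hwW
    filter_upwards [hi.condDistrib_ae_map hW.aemeasurable] with b hb
    have hb' : b ∈ {b | ∫⁻ y, ‖w y‖ₑ ∂κ₀ b < ⊤} := hb.2
    rw [Kernel.piecewise_apply, if_pos hb']

lemma condExp_ae_eq_integral_of_ae_eq_condDistrib [MeasurableSpace S] [StandardBorelSpace S]
    [Nonempty S] {F : Type*} [NormedAddCommGroup F] [NormedSpace ℝ F] [CompleteSpace F]
    (hX : Measurable X) {W : Ω → S} (hW : Measurable W)
    {κ : Kernel β S} (hκ : κ =ᵐ[μ.map X] condDistrib W X μ) {f : β × S → F}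
    (hf : StronglyMeasurable f) (hfi : Integrable (fun ω => f (X ω, W ω)) μ) :
    μ[fun ω => f (X ω, W ω) | mβ.comap X] =ᵐ[μ] fun ω => ∫ y, f (X ω, y) ∂κ (X ω) := by
  refine (condExp_prod_ae_eq_integral_condDistrib hX hW.aemeasurable hf hfi).trans ?_
  filter_upwards [ae_of_ae_map hX.aemeasurable hκ] with ω hω
  rw [hω]

variable {E : Type*} [NormedAddCommGroup E] [InnerProductSpace ℝ E] [FiniteDimensional ℝ E]
  [MeasurableSpace E] [BorelSpace E]

/-- One-period superhedging duality, conditionally on `X`. -/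
theorem exists_superhedge_of_condExp_le (hX : Measurable X) {p : Ω → E} (hpm : Measurable p)
    (hp : Integrable p μ) {x : Ω → ℝ} (hxm : Measurable x) (hx : Integrable x μ)
    {p₀ : β → E} (hp₀ : μ[p | mβ.comap X] =ᵐ[μ] fun ω => p₀ (X ω))
    {x₀ : β → ℝ} (hx₀ : Measurable x₀)
    (H : ∀ θ : β × (E × ℝ) → ℝ, Measurable θ → (∀ z, 0 < θ z) → (∃ C, ∀ z, θ z ≤ C) →
      μ[fun ω => θ (X ω, (p ω, x ω)) • p ω | mβ.comap X] =ᵐ[μ] (fun ω => p₀ (X ω)) →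
      μ[fun ω => θ (X ω, (p ω, x ω)) * x ω | mβ.comap X] ≤ᵐ[μ] fun ω => x₀ (X ω)) :
    ∃ h : β → E, Measurable h ∧
      ∀ᵐ ω ∂μ, inner ℝ (h (X ω)) (p₀ (X ω)) ≤ x₀ (X ω) ∧ x ω ≤ inner ℝ (h (X ω)) (p ω) := by
  have hW : Measurable fun ω => (p ω, x ω) := hpm.prodMk hxm
  obtain ⟨κ, hκM, hκi, hκ⟩ := exists_condDistrib_forall_integrable (S := E × ℝ) hX hW
    (w := fun y => y) stronglyMeasurable_id (hp.prodMk hx)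
  have hκp : ∀ b, Integrable (fun y : E × ℝ => y.1) (κ b) := fun b => (hκi b).fst
  have hκx : ∀ b, Integrable (fun y : E × ℝ => y.2) (κ b) := fun b => (hκi b).snd
  let m : β → E := fun b => ∫ y, y.1 ∂κ b
  have hm : Measurable m := (StronglyMeasurable.integral_kernel
    (measurable_fst.stronglyMeasurable : StronglyMeasurable fun y : E × ℝ => y.1)).measurable
  have hmp₀ : ∀ᵐ ω ∂μ, m (X ω) = p₀ (X ω) := by
    have h1 := condExp_ae_eq_integral_of_ae_eq_condDistrib hX hW hκ (f := fun z => z.2.1)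
      (measurable_fst.comp measurable_snd).stronglyMeasurable hp
    filter_upwards [h1, hp₀] with ω h2 h3
    rw [← h3, h2]
  -- The optimal portfolios of the penalised problems.
  have hsel : ∀ k : ℕ, ∃ h : β → E, Measurable h ∧ ∀ b,
      Real.sigmoid (inner ℝ (h b) (m b) - ((k : ℝ) + 1) * x₀ b) • m b =
        ∫ y, Real.sigmoid (((k : ℝ) + 1) * y.2 - inner ℝ (h b) y.1) • y.1 ∂κ b := by
    intro k
    have hmeas : ∀ h : E, Measurable fun y : E × ℝ =>
        Real.sigmoid (((k : ℝ) + 1) * y.2 - inner ℝ h y.1) • y.1 := fun h =>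
      (continuous_sigmoid.comp (by fun_prop)).measurable.smul measurable_fst
    let f : β → E → ℝ := fun b h =>
      ‖Real.sigmoid (inner ℝ h (m b) - ((k : ℝ) + 1) * x₀ b) • m b -
        ∫ y, Real.sigmoid (((k : ℝ) + 1) * y.2 - inner ℝ h y.1) • y.1 ∂κ b‖
    have hfm : ∀ h, Measurable fun b => f b h := by
      intro h
      refine (Measurable.sub ?_ (StronglyMeasurable.integral_kernel
        (hmeas h).stronglyMeasurable).measurable).norm
      refine Measurable.smul ?_ hm
      exact continuous_sigmoid.measurable.comp
        ((measurable_const.inner hm).sub (hx₀.const_mul _))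
    have hfc : ∀ b, Continuous (f b) := by
      intro b
      refine (Continuous.sub ?_ ?_).norm
      · exact (continuous_sigmoid.comp (by fun_prop)).smul continuous_const
      · refine continuous_of_dominated (bound := fun y => ‖y.1‖)
          (fun h => (hmeas h).aestronglyMeasurable) (fun h => .of_forall fun y => ?_)
          (hκp b).norm (.of_forall fun y => ?_)
        · rw [norm_smul, Real.norm_of_nonneg (Real.sigmoid_nonneg _)]
          exact mul_le_of_le_one_left (norm_nonneg _) (Real.sigmoid_le_one _)
        · exact (continuous_sigmoid.comp (by fun_prop)).smul continuous_const
    obtain ⟨h, hh, hh'⟩ := exists_measurable_selection_sublevel f hfm hfc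
    refine ⟨h, hh, fun b => ?_⟩
    obtain ⟨v, hv⟩ := exists_sigmoid_pricing (hκp b) ((hκx b).const_mul ((k : ℝ) + 1))
      (((k : ℝ) + 1) * x₀ b)
    have := hh' b ⟨v, by simp only [f]; rw [norm_le_zero_iff, sub_eq_zero]; exact hv⟩
    simp only [f] at this
    rwa [norm_le_zero_iff, sub_eq_zero] at this
  choose h hhm hheq using hsel
  let a : ℕ → β → ℝ := fun k b => inner ℝ (h k b) (m b) - ((k : ℝ) + 1) * x₀ b
  let d : ℕ → β × (E × ℝ) → ℝ := fun k z => ((k : ℝ) + 1) * z.2.2 - inner ℝ (h k z.1) z.2.1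
  have ham : ∀ k, Measurable (a k) := fun k => ((hhm k).inner hm).sub (hx₀.const_mul _)
  have hdm : ∀ k, Measurable (d k) := fun k =>
    ((measurable_snd.comp measurable_snd).const_mul _).sub
      (((hhm k).comp measurable_fst).inner (measurable_fst.comp measurable_snd))
  have hσi : ∀ k b, Integrable (fun y => Real.sigmoid (d k (b, y)) • y.1) (κ b) := fun k b =>
    Integrable.bdd_smul (hκp b) 1 (continuous_sigmoid.measurable.comp
      ((hdm k).comp measurable_prodMk_left)).aestronglyMeasurable
      (.of_forall fun y => by
        rw [Real.norm_of_nonneg (Real.sigmoid_nonneg _)]; exact Real.sigmoid_le_one _)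
  have hprice : ∀ k, ∀ᵐ ω ∂μ, ∫ y, Real.sigmoid (d k (X ω, y)) * y.2 ∂κ (X ω) ≤
      Real.sigmoid (a k (X ω)) * x₀ (X ω) := by
    intro k
    -- The ratio of sigmoids is bounded only where its denominator stays away from zero. Elsewhere
    -- the density 1 is used, which also keeps the barycentre; letting `M` vary covers every value,
    -- as the sigmoid is positive.
    have hM : ∀ M : ℕ, ∀ᵐ ω ∂μ, 1 / ((M : ℝ) + 1) < Real.sigmoid (a k (X ω)) →
        ∫ y, Real.sigmoid (d k (X ω, y)) * y.2 ∂κ (X ω) ≤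
          Real.sigmoid (a k (X ω)) * x₀ (X ω) := by
      intro M
      classical
      let θ : β × (E × ℝ) → ℝ := fun z =>
        if 1 / ((M : ℝ) + 1) < Real.sigmoid (a k z.1)
          then Real.sigmoid (d k z) / Real.sigmoid (a k z.1) else 1
      have hσa : Measurable fun z : β × (E × ℝ) => Real.sigmoid (a k z.1) :=
        continuous_sigmoid.measurable.comp ((ham k).comp measurable_fst)
      have hθm : Measurable θ :=
        Measurable.ite (measurableSet_lt measurable_const hσa)
          ((continuous_sigmoid.measurable.comp (hdm k)).div hσa) measurable_const
      have hθ0 : ∀ z, 0 < θ z := by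
        intro z
        simp only [θ]
        split_ifs
        · exact div_pos (Real.sigmoid_pos _) (Real.sigmoid_pos _)
        · exact one_pos
      have hθC : ∀ z, θ z ≤ (M : ℝ) + 1 := by
        intro z
        simp only [θ]
        split_ifs with hz
        · rw [div_le_iff₀ (Real.sigmoid_pos _)]
          rw [div_lt_iff₀' (by positivity)] at hz
          exact (Real.sigmoid_le_one _).trans hz.le
        · linarith [Nat.cast_nonneg (α := ℝ) M]
      have hθn : ∀ z, ‖θ z‖ ≤ (M : ℝ) + 1 := fun z => by
        rw [Real.norm_of_nonneg (hθ0 z).le]; exact hθC z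
      have hθW : AEStronglyMeasurable (fun ω => θ (X ω, (p ω, x ω))) μ :=
        (hθm.comp (hX.prodMk hW)).aestronglyMeasurable
      have h1 := condExp_ae_eq_integral_of_ae_eq_condDistrib hX hW hκ
        (f := fun z => θ z • z.2.1)
        (hθm.smul (measurable_fst.comp measurable_snd)).stronglyMeasurable
        (Integrable.bdd_smul hp _ hθW (.of_forall fun ω => hθn _))
      have h2 := condExp_ae_eq_integral_of_ae_eq_condDistrib hX hW hκ
        (f := fun z => θ z * z.2.2)
        (hθm.mul (measurable_snd.comp measurable_snd)).stronglyMeasurable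
        (Integrable.bdd_smul hx _ hθW (.of_forall fun ω => hθn _))
      have h3 : ∀ b, ∫ y, θ (b, y) • y.1 ∂κ b = m b := by
        intro b
        by_cases hb : 1 / ((M : ℝ) + 1) < Real.sigmoid (a k b)
        · simp only [θ, hb, if_true]
          simp only [div_eq_inv_mul, ← smul_smul]
          rw [integral_smul, ← hheq k b, smul_smul, inv_mul_cancel₀ (Real.sigmoid_pos _).ne',
            one_smul]
        · simp only [θ, hb, if_false, one_smul]
          rfl
      have h4 := H θ hθm hθ0 ⟨_, hθC⟩ (by
        filter_upwards [h1, hmp₀] with ω h5 h6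
        rw [h5, h3, h6])
      filter_upwards [h4, h2] with ω h5 h6 hω
      rw [h6] at h5
      simp only [θ, hω, if_true, div_mul_eq_mul_div] at h5
      rwa [integral_div, div_le_iff₀' (Real.sigmoid_pos _)] at h5
    filter_upwards [ae_all_iff.2 hM] with ω hω
    obtain ⟨M, hM⟩ := exists_nat_one_div_lt (Real.sigmoid_pos (a k (X ω)))
    exact hω M hM
  have hex : ∀ᵐ ω ∂μ, ∃ v : E, inner ℝ v (m (X ω)) ≤ x₀ (X ω) ∧
      ∀ᵐ y ∂κ (X ω), y.2 ≤ inner ℝ v y.1 := by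
    filter_upwards [ae_all_iff.2 hprice] with ω hω
    refine exists_superhedge_of_sigmoid_le (hκp _) (hκx _) _ fun k => ⟨h k (X ω), ?_⟩
    have h1 := hω k
    have hσx : Integrable (fun y => Real.sigmoid (d k (X ω, y)) * y.2) (κ (X ω)) :=
      Integrable.bdd_smul (hκx _) 1 (continuous_sigmoid.measurable.comp
        ((hdm k).comp measurable_prodMk_left)).aestronglyMeasurable
        (.of_forall fun y => (Real.norm_of_nonneg (Real.sigmoid_nonneg _)).trans_le
          (Real.sigmoid_le_one _))
    have h2 : ∫ y, (((k : ℝ) + 1) * y.2 - inner ℝ (h k (X ω)) y.1) *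
        Real.sigmoid (((k : ℝ) + 1) * y.2 - inner ℝ (h k (X ω)) y.1) ∂κ (X ω) =
        ((k : ℝ) + 1) * ∫ y, Real.sigmoid (d k (X ω, y)) * y.2 ∂κ (X ω) -
          inner ℝ (h k (X ω)) (∫ y, Real.sigmoid (d k (X ω, y)) • y.1 ∂κ (X ω)) := by
      rw [← integral_inner (hσi k _), ← integral_const_mul,
        ← integral_sub (hσx.const_mul _) ((hσi k _).const_inner _)]
      congr 1 with y
      simp only [d, real_inner_smul_right]
      ring
    -- By the first-order condition the terms in `h` cancel, and the cost reduces to $k+1$ times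
    -- $\int\sigma(d)x-\sigma(a)x_0$, which is nonpositive by `hprice`.
    rw [h2, ← hheq k (X ω), real_inner_smul_right]
    change a k (X ω) * Real.sigmoid (a k (X ω)) + (_ - Real.sigmoid (a k (X ω)) * _) ≤ 0
    have h3 : a k (X ω) = inner ℝ (h k (X ω)) (m (X ω)) - ((k : ℝ) + 1) * x₀ (X ω) := rfl
    have h4 : inner ℝ (h k (X ω)) (m (X ω)) = a k (X ω) + ((k : ℝ) + 1) * x₀ (X ω) := by
      rw [h3]; ring
    rw [h4]
    have hk : (0 : ℝ) < (k : ℝ) + 1 := by positivity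
    nlinarith [mul_le_mul_of_nonneg_left h1 hk.le]
  obtain ⟨u, hum, hu⟩ := exists_measurable_selection_sublevel
    (fun (b : β) (v : E) => max (inner ℝ v (m b) - x₀ b) 0 +
      ∫ y, max (y.2 - inner ℝ v y.1) 0 ∂κ b)
    (fun v => (((measurable_const.inner hm).sub hx₀).max measurable_const).add
      (StronglyMeasurable.integral_kernel (Continuous.stronglyMeasurable (by fun_prop))).measurable)
    (fun b => Continuous.add (by fun_prop)
      (continuous_integral_lipschitz_sub_inner lipschitzWith_max_zero (hκp b) (hκx b)))
  have hu' : ∀ᵐ ω ∂μ, inner ℝ (u (X ω)) (m (X ω)) ≤ x₀ (X ω) ∧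
      ∀ᵐ y ∂κ (X ω), y.2 ≤ inner ℝ (u (X ω)) y.1 := by
    filter_upwards [hex] with ω ⟨v, hv1, hv2⟩
    have h1 : max (inner ℝ (u (X ω)) (m (X ω)) - x₀ (X ω)) 0 +
        ∫ y, max (y.2 - inner ℝ (u (X ω)) y.1) 0 ∂κ (X ω) ≤ 0 := by
      refine hu (X ω) ⟨v, le_of_eq ?_⟩
      rw [max_eq_right (by linarith), zero_add]
      refine integral_eq_zero_of_ae ?_
      filter_upwards [hv2] with y hy
      exact max_eq_right (by linarith)
    have h2 : 0 ≤ ∫ y, max (y.2 - inner ℝ (u (X ω)) y.1) 0 ∂κ (X ω) :=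
      integral_nonneg fun y => le_max_right _ _
    have h3 := le_max_left (inner ℝ (u (X ω)) (m (X ω)) - x₀ (X ω)) 0
    have h4 := le_max_right (inner ℝ (u (X ω)) (m (X ω)) - x₀ (X ω)) 0
    refine ⟨by linarith, ?_⟩
    have h5 : ∫ y, max (y.2 - inner ℝ (u (X ω)) y.1) 0 ∂κ (X ω) = 0 :=
      le_antisymm (by linarith) h2
    have h6 := (integral_eq_zero_iff_of_nonneg (fun y => le_max_right _ _)
      (integrable_lipschitz_sub_inner lipschitzWith_max_zero (hκp _) (hκx _) _)).1 h5
    filter_upwards [h6] with y hy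
    have := le_max_left (y.2 - inner ℝ (u (X ω)) y.1) 0
    simp only [Pi.zero_apply] at hy
    linarith
  have hset : MeasurableSet {z : β × (E × ℝ) | z.2.2 ≤ inner ℝ (u z.1) z.2.1} :=
    measurableSet_le (measurable_snd.comp measurable_snd)
      ((hum.comp measurable_fst).inner (measurable_fst.comp measurable_snd))
  -- The joint law of `X` and `(p, x)` disintegrates through `κ`, so a fibrewise almost sure
  -- inequality holds almost surely on `Ω`.
  have hae : ∀ᵐ z ∂(μ.map fun ω => (X ω, (p ω, x ω))), z.2.2 ≤ inner ℝ (u z.1) z.2.1 := by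
    rw [← compProd_map_condDistrib hW.aemeasurable, ← Measure.compProd_congr hκ,
      Measure.ae_compProd_iff hset, ae_map_iff hX.aemeasurable ?_]
    swap
    · simp only [ae_iff]
      exact measurableSet_eq_fun (Kernel.measurable_kernel_prodMk_left hset.compl)
        measurable_const
    filter_upwards [hu'] with ω hω using hω.2
  refine ⟨u, hum, ?_⟩
  filter_upwards [hu', hmp₀, ae_of_ae_map (hX.prodMk hW).aemeasurable hae] with ω h1 h2 h3
  exact ⟨by rw [← h2]; exact h1.1, h3⟩

end Conditional

/-! ### One-period changes of density that tame a random variable. -/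

open Filter Topology in
lemma exists_nat_measure_lt_abs_le {Ω : Type*} {mΩ : MeasurableSpace Ω} {μ : Measure Ω}
    [IsFiniteMeasure μ] {g : Ω → ℝ} (hgm : Measurable g) {ε : ℝ} (hε : 0 < ε) :
    ∃ M : ℕ, μ {ω | (M : ℝ) < |g ω|} ≤ ENNReal.ofReal ε := by
  have hanti : Antitone fun M : ℕ => {ω | (M : ℝ) < |g ω|} := by
    intro M N hMN ω hω
    exact lt_of_le_of_lt (by exact_mod_cast hMN : (M : ℝ) ≤ N) hω
  have hlim := tendsto_measure_iInter_atTop (μ := μ) (s := fun M : ℕ => {ω | (M : ℝ) < |g ω|})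
    (fun M => (measurableSet_lt measurable_const hgm.abs).nullMeasurableSet) hanti
    ⟨0, measure_ne_top _ _⟩
  have hempty : ⋂ M : ℕ, {ω | (M : ℝ) < |g ω|} = ∅ := by
    ext ω
    simp only [Set.mem_iInter, Set.mem_ofPred_eq, Set.mem_empty_iff_false, iff_false, not_forall,
      not_lt]
    exact exists_nat_ge _
  rw [hempty, measure_empty] at hlim
  exact (hlim.eventually_le_const (by simpa using hε)).exists

lemma integrable_smul_of_pos_of_le {Ω E : Type*} {mΩ : MeasurableSpace Ω} {μ : Measure Ω}
    [NormedAddCommGroup E] [NormedSpace ℝ E] {p : Ω → E} (hp : Integrable p μ) {φ : Ω → ℝ}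
    (hφ : Measurable φ) (hφ0 : ∀ ω, 0 < φ ω) {C : ℝ} (hφC : ∀ ω, φ ω ≤ C) :
    Integrable (fun ω => φ ω • p ω) μ :=
  Integrable.bdd_smul hp C hφ.aestronglyMeasurable
    (.of_forall fun ω => (Real.norm_of_nonneg (hφ0 ω).le).trans_le (hφC ω))

lemma continuous_integral_bounded_weight_correction {S E : Type*} [MeasurableSpace S]
    {κ : Measure S} [NormedAddCommGroup E] [InnerProductSpace ℝ E] {p : S → E}
    (hp : Integrable p κ) {w : S → ℝ} (hw : AEStronglyMeasurable w κ) (hw0 : ∀ s, 0 < w s)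
    (hw1 : ∀ s, w s ≤ 1) {r : S → ℝ} (hr : Integrable (fun s => r s • p s) κ) :
    Continuous fun l : E =>
      ∫ s, (r s + w s * ((1 + ‖p s‖)⁻¹ * inner ℝ l (p s))) • p s ∂κ := by
  have hint := integrable_bounded_weight_correction hp hw hw0 hw1
  simp only [add_smul]
  refine (LipschitzWith.of_dist_le_mul (K := (∫ s, ‖p s‖ ∂κ).toNNReal) fun l l' => ?_).continuous
  rw [Real.coe_toNNReal _ (integral_nonneg fun _ => norm_nonneg _),
    integral_add hr (hint l), integral_add hr (hint l'), dist_add_left, dist_eq_norm,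
    ← integral_sub (hint l) (hint l'), ← integral_mul_const]
  refine norm_integral_le_of_norm_le (hp.norm.mul_const _) (.of_forall fun s => ?_)
  rw [← sub_smul, ← mul_sub, ← mul_sub, ← inner_sub_left, norm_smul, norm_mul,
    Real.norm_of_nonneg (hw0 s).le, mul_comm, dist_eq_norm]
  refine mul_le_mul_of_nonneg_left ?_ (norm_nonneg _)
  exact (mul_le_of_le_one_left (norm_nonneg _) (hw1 s)).trans
    (abs_inv_one_add_norm_mul_inner_le _ _)

section Conditional

open ProbabilityTheory

variable {Ω β : Type*} {mΩ : MeasurableSpace Ω} {mβ : MeasurableSpace β}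
  {μ : Measure Ω} [IsProbabilityMeasure μ] {X : Ω → β}
  {E : Type*} [NormedAddCommGroup E] [InnerProductSpace ℝ E] [FiniteDimensional ℝ E]
  [MeasurableSpace E] [BorelSpace E]

open Filter Topology in
/-- A small perturbation of the reference measure that preserves the conditional barycentre of `p`,
up to a constant, and makes a given random variable `g` conditionally bounded. -/
theorem exists_perturbation_same_condExp (hX : Measurable X) {p : Ω → E} (hpm : Measurable p)
    (hp : Integrable p μ) {g : Ω → ℝ} (hgm : Measurable g) {ε : ℝ} (hε : 0 < ε) :
    ∃ (c : ℝ) (Φ : β × (E × ℝ) → ℝ) (G : β → ℝ), Real.exp (-ε) ≤ c ∧ c ≤ 1 ∧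
      Measurable Φ ∧ (∀ z, 0 < Φ z) ∧ (∀ z, Φ z ≤ 1) ∧ Measurable G ∧
      (∀ z, Φ z * |z.2.2| ≤ G z.1) ∧
      μ[fun ω => Φ (X ω, (p ω, g ω)) • p ω | mβ.comap X] =ᵐ[μ] c • μ[p | mβ.comap X] ∧
      μ {ω | Φ (X ω, (p ω, g ω)) < Real.exp (-ε)} ≤ ENNReal.ofReal ε := by
  have hW : Measurable fun ω => (p ω, g ω) := hpm.prodMk hgm
  obtain ⟨κ, hκM, hκp, hκ⟩ := exists_condDistrib_forall_integrable (S := E × ℝ) hX hW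
    (w := fun y => y.1) measurable_fst.stronglyMeasurable hp
  -- The three factors are the lower bounds for the correction, for the truncation where $|g|\le M$,
  -- and for the normalisation that keeps $\Phi\le1$.
  obtain ⟨δ, hδ0, hδ1, hδε⟩ : ∃ δ : ℝ, 0 < δ ∧ δ < 1 ∧
      Real.exp (-ε) < (1 - δ) * (1 + δ)⁻¹ * (1 + δ)⁻¹ := by
    have hcont : ContinuousAt (fun δ : ℝ => (1 - δ) * (1 + δ)⁻¹ * (1 + δ)⁻¹) 0 := by
      have : ContinuousAt (fun δ : ℝ => (1 + δ)⁻¹) 0 :=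
        ContinuousAt.inv₀ (by fun_prop) (by norm_num)
      exact ((by fun_prop : ContinuousAt (fun δ : ℝ => 1 - δ) 0).mul this).mul this
    have h1 : Real.exp (-ε) < (fun δ : ℝ => (1 - δ) * (1 + δ)⁻¹ * (1 + δ)⁻¹) 0 := by
      simpa using hε
    have h2 := (hcont.eventually_const_lt h1).filter_mono
      (nhdsWithin_le_nhds (s := Set.Ioi (0 : ℝ)))
    obtain ⟨δ, h3, h4, h5⟩ := (h2.and (Ioo_mem_nhdsGT (one_pos : (0 : ℝ) < 1))).exists
    exact ⟨δ, h4, h5, h3⟩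
  have hδi : (0 : ℝ) < (1 + δ)⁻¹ := by positivity
  have hδi1 : (1 + δ)⁻¹ ≤ 1 := inv_le_one_of_one_le₀ (by linarith)
  obtain ⟨M, hM⟩ := exists_nat_measure_lt_abs_le (μ := μ) hgm hε
  obtain ⟨N₀, hN₀⟩ := exists_nat_ge ((M : ℝ) / δ)
  -- The weights.
  let φ : ℕ → ℝ → ℝ := fun N t => (1 + |t| / ((N : ℝ) + 1))⁻¹
  let ψ : (E × ℕ) × (E × ℝ) → ℝ := fun z => φ z.1.2 z.2.2 +
    (1 + |z.2.2|)⁻¹ * ((1 + ‖z.2.1‖)⁻¹ * inner ℝ z.1.1 z.2.1)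
  have hφm : ∀ N, Measurable (φ N) := fun N =>
    ((measurable_id.abs.div_const _).const_add 1).inv
  have hφ0 : ∀ N t, 0 < φ N t := fun N t => by simp only [φ]; positivity
  have hφ1 : ∀ N t, φ N t ≤ 1 := fun N t =>
    inv_le_one_of_one_le₀ (by linarith [show 0 ≤ |t| / ((N : ℝ) + 1) by positivity])
  have hφN : ∀ (N : ℕ) t, (1 + |t|)⁻¹ ≤ φ N t := by
    intro N t
    refine inv_anti₀ (by positivity) ?_
    have : |t| / ((N : ℝ) + 1) ≤ |t| := div_le_self (abs_nonneg _)
      (by linarith [N.cast_nonneg (α := ℝ)])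
    linarith
  have hw0 : ∀ t : ℝ, 0 < (1 + |t|)⁻¹ := fun t => by positivity
  have hw1 : ∀ t : ℝ, (1 + |t|)⁻¹ ≤ 1 := fun t => by simpa [φ] using hφ1 0 t
  have hwm : Measurable fun t : ℝ => (1 + |t|)⁻¹ := (measurable_id.abs.const_add 1).inv
  have hψm : Measurable ψ := by
    refine Measurable.add ?_ ?_
    · exact ((measurable_snd.comp measurable_snd).abs.div
        ((measurable_from_nat.comp (measurable_snd.comp measurable_fst)).add_const 1)
        |>.const_add 1).inv
    · refine (hwm.comp (measurable_snd.comp measurable_snd)).mul (Measurable.mul ?_ ?_)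
      · exact ((measurable_fst.comp measurable_snd).norm.const_add 1).inv
      · exact (measurable_fst.comp measurable_fst).inner (measurable_fst.comp measurable_snd)
  have hcorr : ∀ (l v : E) (t : ℝ), ‖l‖ ≤ δ →
      |(1 + |t|)⁻¹ * ((1 + ‖v‖)⁻¹ * inner ℝ l v)| ≤ δ * (1 + |t|)⁻¹ := by
    intro l v t hl
    rw [abs_mul, abs_of_pos (hw0 t), mul_comm]
    exact mul_le_mul_of_nonneg_right ((abs_inv_one_add_norm_mul_inner_le l v).trans hl) (hw0 t).le
  have hφi : ∀ N b, Integrable (fun y : E × ℝ => φ N y.2 • y.1) (κ b) := fun N b =>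
    integrable_smul_of_pos_of_le (hκp b) ((hφm N).comp measurable_snd) (fun y => hφ0 N y.2)
      fun y => hφ1 N y.2
  -- Measurable choice of the parameters.
  let f : β → E × ℕ → ℝ := fun b l => ‖∫ y, ψ (l, y) • y.1 ∂κ b - ∫ y, y.1 ∂κ b‖ +
    (max (‖l.1‖ - δ) 0 + max ((N₀ : ℝ) - l.2) 0)
  have hfm : ∀ l, Measurable fun b => f b l := fun l =>
    ((StronglyMeasurable.integral_kernel ((hψm.comp measurable_prodMk_left).smul
      measurable_fst).stronglyMeasurable).measurable.sub (StronglyMeasurable.integral_kernel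
        measurable_fst.stronglyMeasurable).measurable).norm.add_const _
  have hfc : ∀ b, Continuous (f b) := by
    intro b
    refine continuous_prod_of_discrete_right.2 fun N => ?_
    refine Continuous.add ?_ (by fun_prop)
    refine Continuous.norm (Continuous.sub ?_ continuous_const)
    exact continuous_integral_bounded_weight_correction (hκp b)
      (hwm.comp measurable_snd).aestronglyMeasurable (fun y => hw0 y.2) (fun y => hw1 y.2)
      (hφi N b)
  -- All summands of `f` are nonnegative, so its zero sublevel encodes the barycentre equation
  -- together with $\|l\|\le\delta$ and $N\ge N_0$.
  obtain ⟨l, hlm, hl⟩ := exists_measurable_selection_sublevel f hfm hfc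
  have hsol : ∀ b, ∫ y, ψ (l b, y) • y.1 ∂κ b = ∫ y, y.1 ∂κ b ∧ ‖(l b).1‖ ≤ δ ∧
      N₀ ≤ (l b).2 := by
    intro b
    obtain ⟨v, N, hN, hv, heq⟩ := exists_truncation_with_same_barycentre (hκp b)
      (measurable_snd.aestronglyMeasurable : AEStronglyMeasurable (fun y : E × ℝ => y.2) (κ b))
      hδ0 N₀
    have h1 := hl b ⟨(v, N), le_of_eq ?_⟩
    · have h2 := norm_nonneg (∫ y, ψ (l b, y) • y.1 ∂κ b - ∫ y, y.1 ∂κ b)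
      have h3 := le_max_left (‖(l b).1‖ - δ) 0
      have h4 := le_max_right (‖(l b).1‖ - δ) 0
      have h5 := le_max_left ((N₀ : ℝ) - (l b).2) 0
      have h6 := le_max_right ((N₀ : ℝ) - (l b).2) 0
      simp only [f] at h1
      refine ⟨?_, by linarith, ?_⟩
      · rw [← sub_eq_zero, ← norm_le_zero_iff]
        linarith
      · have : (N₀ : ℝ) ≤ (l b).2 := by linarith
        exact_mod_cast this
    · have h2 : ∫ y, ψ ((v, N), y) • y.1 ∂κ b = ∫ y, y.1 ∂κ b := heq
      have h3 : (N₀ : ℝ) ≤ N := by exact_mod_cast hN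
      simp only [f]
      rw [h2, sub_self, norm_zero, max_eq_right (by linarith), max_eq_right (by linarith)]
      norm_num
  have hψle : ∀ z : β × (E × ℝ), ψ (l z.1, z.2) ≤ (1 + δ) * φ (l z.1).2 z.2.2 := by
    intro z
    have h1 := (abs_le.1 (hcorr _ z.2.1 z.2.2 (hsol z.1).2.1)).2
    have h2 := mul_le_mul_of_nonneg_left (hφN (l z.1).2 z.2.2) hδ0.le
    simp only [ψ]
    linarith
  have hψge : ∀ z : β × (E × ℝ), (1 - δ) * φ (l z.1).2 z.2.2 ≤ ψ (l z.1, z.2) := by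
    intro z
    have h1 := (abs_le.1 (hcorr _ z.2.1 z.2.2 (hsol z.1).2.1)).1
    have h2 := mul_le_mul_of_nonneg_left (hφN (l z.1).2 z.2.2) hδ0.le
    simp only [ψ]
    linarith
  let Φ : β × (E × ℝ) → ℝ := fun z => (1 + δ)⁻¹ * ψ (l z.1, z.2)
  have hΦm : Measurable Φ :=
    (hψm.comp ((hlm.comp measurable_fst).prodMk measurable_snd)).const_mul _
  have hΦ0 : ∀ z, 0 < Φ z := fun z =>
    mul_pos hδi ((mul_pos (by linarith) (hφ0 _ _)).trans_le (hψge z))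
  have hΦφ : ∀ z, Φ z ≤ φ (l z.1).2 z.2.2 := fun z => by
    simp only [Φ]
    rw [inv_mul_le_iff₀ (by linarith)]
    exact hψle z
  have hΦ1 : ∀ z, Φ z ≤ 1 := fun z => (hΦφ z).trans (hφ1 _ _)
  refine ⟨(1 + δ)⁻¹, Φ, fun b => ((l b).2 : ℝ) + 1, ?_, hδi1, hΦm, hΦ0, hΦ1,
    (measurable_from_nat.comp (measurable_snd.comp hlm)).add_const 1, fun z => ?_, ?_, ?_⟩
  · refine hδε.le.trans (mul_le_of_le_one_left hδi.le ?_)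
    exact mul_le_one₀ (by linarith) hδi.le hδi1
  · refine (mul_le_mul_of_nonneg_right (hΦφ z) (abs_nonneg _)).trans ?_
    simp only [φ]
    rw [inv_mul_le_iff₀ (by positivity)]
    have h1 : ((l z.1).2 : ℝ) + 1 ≠ 0 := by positivity
    have h2 : (1 + |z.2.2| / (((l z.1).2 : ℝ) + 1)) * (((l z.1).2 : ℝ) + 1) =
        (((l z.1).2 : ℝ) + 1) + |z.2.2| := by
      field_simp
    rw [h2]
    linarith [((l z.1).2).cast_nonneg (α := ℝ)]
  · have h1 := condExp_ae_eq_integral_of_ae_eq_condDistrib hX hW hκ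
      (f := fun z => Φ z • z.2.1)
      (hΦm.smul (measurable_fst.comp measurable_snd)).stronglyMeasurable
      (integrable_smul_of_pos_of_le hp (hΦm.comp (hX.prodMk hW)) (fun _ => hΦ0 _) fun _ => hΦ1 _)
    have h2 := condExp_ae_eq_integral_of_ae_eq_condDistrib hX hW hκ
      (f := fun z => z.2.1) (measurable_fst.comp measurable_snd).stronglyMeasurable hp
    filter_upwards [h1, h2] with ω h3 h4
    rw [h3, Pi.smul_apply, h4]
    simp only [Φ, ← smul_smul]
    rw [integral_smul, (hsol (X ω)).1]
  · refine (measure_mono fun ω hω => ?_).trans hM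
    simp only [Set.mem_ofPred_eq] at hω ⊢
    by_contra hcon
    rw [not_lt] at hcon
    refine absurd hω (not_lt.2 (hδε.le.trans ?_))
    have h1 : (1 + δ)⁻¹ ≤ φ (l (X ω)).2 (g ω) := by
      refine inv_anti₀ (by positivity) ?_
      rw [add_le_add_iff_left, div_le_iff₀ (by positivity)]
      have h2 : (N₀ : ℝ) ≤ (l (X ω)).2 := by exact_mod_cast (hsol (X ω)).2.2
      rw [div_le_iff₀' hδ0] at hN₀
      nlinarith
    have h2 := hψge (X ω, (p ω, g ω))
    simp only [Φ]
    rw [mul_comm]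
    refine mul_le_mul_of_nonneg_left ?_ hδi.le
    exact (mul_le_mul_of_nonneg_left h1 (by linarith)).trans h2

end Conditional

section SubSigmaAlgebra

variable {Ω : Type*} {m m₁ mΩ : MeasurableSpace Ω} {μ : Measure Ω} [IsProbabilityMeasure μ]
  {E : Type*} [NormedAddCommGroup E] [InnerProductSpace ℝ E] [FiniteDimensional ℝ E]
  [MeasurableSpace E] [BorelSpace E]

/-- Conditioning on `m` is conditioning on the identity map into `(Ω, m)`. Only the law of `(p, g)`
is disintegrated, so `Ω` itself need not be standard Borel. -/
lemma exists_measurable_perturbation_same_condExp (hm : m ≤ m₁) (hm₁ : m₁ ≤ mΩ) {p : Ω → E}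
    (hpm : Measurable[m₁] p) (hp : Integrable p μ) {g : Ω → ℝ} (hgm : Measurable[m₁] g)
    {ε : ℝ} (hε : 0 < ε) :
    ∃ (c : ℝ) (φ G : Ω → ℝ), Real.exp (-ε) ≤ c ∧ c ≤ 1 ∧
      Measurable[m₁] φ ∧ (∀ ω, 0 < φ ω) ∧ (∀ ω, φ ω ≤ 1) ∧ Measurable[m] G ∧
      (∀ ω, φ ω * |g ω| ≤ G ω) ∧
      μ[fun ω => φ ω • p ω | m] =ᵐ[μ] c • μ[p | m] ∧
      μ {ω | φ ω < Real.exp (-ε)} ≤ ENNReal.ofReal ε := by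
  obtain ⟨c, Φ, G, h1, h2, h3, h4, h5, h6, h7, h8, h9⟩ :=
    exists_perturbation_same_condExp (mβ := m) (X := fun ω : Ω => ω)
      (measurable_id'' (hm.trans hm₁)) (hpm.mono hm₁ le_rfl) hp (hgm.mono hm₁ le_rfl) hε
  rw [show m.comap (fun ω : Ω => ω) = m from MeasurableSpace.comap_id] at h8
  refine ⟨c, fun ω => Φ (ω, (p ω, g ω)), G, h1, h2, ?_, fun ω => h4 _, fun ω => h5 _, h6,
    fun ω => h7 (ω, (p ω, g ω)), h8, h9⟩
  exact h3.comp ((measurable_id'' hm).prodMk (hpm.prodMk hgm))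

lemma exists_measurable_superhedge_of_condExp_le (hm : m ≤ m₁) (hm₁ : m₁ ≤ mΩ) {p : Ω → E}
    (hpm : Measurable[m₁] p) (hp : Integrable p μ) {x : Ω → ℝ} (hxm : Measurable[m₁] x)
    (hx : Integrable x μ) {p₀ : Ω → E} (hp₀ : μ[p | m] =ᵐ[μ] p₀)
    {x₀ : Ω → ℝ} (hx₀ : Measurable[m] x₀)
    (H : ∀ θ : Ω → ℝ, Measurable[m₁] θ → (∀ ω, 0 < θ ω) → (∃ C, ∀ ω, θ ω ≤ C) →
      μ[fun ω => θ ω • p ω | m] =ᵐ[μ] p₀ → μ[fun ω => θ ω * x ω | m] ≤ᵐ[μ] x₀) :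
    ∃ h : Ω → E, Measurable[m] h ∧
      ∀ᵐ ω ∂μ, inner ℝ (h ω) (p₀ ω) ≤ x₀ ω ∧ x ω ≤ inner ℝ (h ω) (p ω) := by
  have hid : m.comap (fun ω : Ω => ω) = m := MeasurableSpace.comap_id
  refine exists_superhedge_of_condExp_le (mβ := m) (X := fun ω : Ω => ω)
    (measurable_id'' (hm.trans hm₁)) (hpm.mono hm₁ le_rfl) hp (hxm.mono hm₁ le_rfl) hx
    (by rw [hid]; exact hp₀) hx₀ fun θ hθ hθ0 hθC hθp => ?_
  rw [hid] at hθp ⊢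
  obtain ⟨C, hC⟩ := hθC
  exact H (fun ω => θ (ω, (p ω, x ω)))
    (hθ.comp ((measurable_id'' hm).prodMk (hpm.prodMk hxm)))
    (fun ω => hθ0 _) ⟨C, fun ω => hC _⟩ hθp

end SubSigmaAlgebra

/-! ### Density processes that preserve the martingale property. -/

lemma condExp_smul_martingale_succ {Ω E : Type*} {mΩ : MeasurableSpace Ω}
    {μ : Measure Ω} {ℱ : Filtration ℕ mΩ} [NormedAddCommGroup E] [NormedSpace ℝ E] [CompleteSpace E]
    {P : ℕ → Ω → E} (hP : Martingale P ℱ μ) {u : ℕ} {φ : Ω → ℝ}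
    (hφ : Measurable[ℱ u] φ) (hφ0 : ∀ ω, 0 < φ ω) {C : ℝ} (hφC : ∀ ω, φ ω ≤ C) :
    μ[fun ω => φ ω • P (u + 1) ω | ℱ u] =ᵐ[μ] fun ω => φ ω • P u ω := by
  have h1 := condExp_smul_of_aestronglyMeasurable_left (μ := μ) (m := ℱ u)
    hφ.stronglyMeasurable.aestronglyMeasurable
    (integrable_smul_of_pos_of_le (hP.integrable (u + 1)) (hφ.mono (ℱ.le u) le_rfl) hφ0 hφC)
    (hP.integrable (u + 1))
  refine h1.trans ?_
  filter_upwards [hP.2 u (u + 1) u.le_succ] with ω hω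
  simp [hω]

section DensityProcess

variable {Ω : Type*} {mΩ : MeasurableSpace Ω} {μ : Measure Ω} [IsProbabilityMeasure μ]
  {ℱ : Filtration ℕ mΩ}
  {E : Type*} [NormedAddCommGroup E] [InnerProductSpace ℝ E] [FiniteDimensional ℝ E]
  {P : ℕ → Ω → E}

lemma martingale_smul_of_forall_condExp_succ (hP : Martingale P ℱ μ) {Λ : ℕ → Ω → ℝ}
    (hΛ : Adapted ℱ Λ) (hΛ0 : ∀ u ω, 0 < Λ u ω) (hΛC : ∀ u, ∃ C, ∀ ω, Λ u ω ≤ C)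
    (h : ∀ u, μ[fun ω => Λ (u + 1) ω • P (u + 1) ω | ℱ u] =ᵐ[μ] fun ω => Λ u ω • P u ω) :
    Martingale (fun u ω => Λ u ω • P u ω) ℱ μ := by
  refine martingale_nat (fun u => (hΛ u).stronglyMeasurable.smul (hP.1 u)) (fun u => ?_)
    fun u => (h u).symm
  obtain ⟨C, hC⟩ := hΛC u
  exact integrable_smul_of_pos_of_le (hP.integrable u) ((hΛ u).mono (ℱ.le u) le_rfl) (hΛ0 u) hC

/-- Splicing of a bounded density up to time `t` with a one-period change of density. -/
lemma martingale_splice (hP : Martingale P ℱ μ) {Λ : ℕ → Ω → ℝ} (hΛ : Adapted ℱ Λ)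
    (hΛ0 : ∀ u ω, 0 < Λ u ω) (hΛ1 : ∀ u ω, Λ u ω ≤ 1)
    (hΛP : Martingale (fun u ω => Λ u ω • P u ω) ℱ μ) (t : ℕ) {c : ℝ} (hc : 0 < c)
    {φ : Ω → ℝ} (hφ : Measurable[ℱ (t + 1)] φ) (hφ0 : ∀ ω, 0 < φ ω) {C : ℝ}
    (hφC : ∀ ω, φ ω ≤ C)
    (hφP : μ[fun ω => φ ω • P (t + 1) ω | ℱ t] =ᵐ[μ] fun ω => c • P t ω) :
    Adapted ℱ (fun u ω => if u ≤ t then c * Λ u ω else Λ t ω * φ ω) ∧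
      Martingale (fun u ω => (if u ≤ t then c * Λ u ω else Λ t ω * φ ω) • P u ω) ℱ μ := by
  have hψ : ∀ u, t < u → Measurable[ℱ u] fun ω => Λ t ω * φ ω := fun u hu =>
    ((hΛ t).mono (ℱ.mono hu.le) le_rfl).mul (hφ.mono (ℱ.mono hu) le_rfl)
  have hψ0 : ∀ ω, 0 < Λ t ω * φ ω := fun ω => mul_pos (hΛ0 t ω) (hφ0 ω)
  have hψC : ∀ ω, Λ t ω * φ ω ≤ C := fun ω =>
    (mul_le_of_le_one_left (hφ0 ω).le (hΛ1 t ω)).trans (hφC ω)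
  have hA : Adapted ℱ (fun u ω => if u ≤ t then c * Λ u ω else Λ t ω * φ ω) := by
    intro u
    by_cases hu : u ≤ t
    · simp only [hu, if_true]
      exact (hΛ u).const_mul c
    · simp only [hu, if_false]
      exact hψ u (not_le.1 hu)
  refine ⟨hA, martingale_smul_of_forall_condExp_succ hP hA (fun u ω => ?_) (fun u => ?_)
    fun u => ?_⟩
  · split_ifs
    · exact mul_pos hc (hΛ0 u ω)
    · exact hψ0 ω
  · by_cases hu : u ≤ t
    · exact ⟨c, fun ω => by simp only [hu, if_true]; exact mul_le_of_le_one_right hc.le (hΛ1 u ω)⟩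
    · exact ⟨C, fun ω => by simp only [hu, if_false]; exact hψC ω⟩
  · rcases lt_trichotomy u t with hu | rfl | hu
    · have h1 : u + 1 ≤ t := hu
      simp only [h1, hu.le, if_true, mul_smul]
      refine (condExp_smul c (fun ω => Λ (u + 1) ω • P (u + 1) ω) (ℱ u)).trans ?_
      filter_upwards [hΛP.2 u (u + 1) u.le_succ] with ω hω
      simp [hω]
    -- Only at the splice does the density change over a period; there `hφP` produces the constant
    -- `c` carried by all earlier times.
    · simp only [le_refl, if_true, Nat.succ_le_iff, lt_irrefl, if_false, mul_smul]
      have hi := integrable_smul_of_pos_of_le (hP.integrable (u + 1))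
        (hφ.mono (ℱ.le (u + 1)) le_rfl) hφ0 hφC
      have h1 := condExp_smul_of_aestronglyMeasurable_left (μ := μ) (m := ℱ u)
        (hΛ u).stronglyMeasurable.aestronglyMeasurable
        (integrable_smul_of_pos_of_le hi ((hΛ u).mono (ℱ.le u) le_rfl) (hΛ0 u) (hΛ1 u)) hi
      refine h1.trans ?_
      filter_upwards [hφP] with ω hω
      rw [Pi.smul_apply', hω, smul_comm]
    · simp only [not_le.2 hu, not_le.2 (hu.trans u.lt_succ_self), if_false]
      exact condExp_smul_martingale_succ hP (hψ u hu) hψ0 hψC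

variable [MeasurableSpace E] [BorelSpace E]

/-- A bounded change of density, close to one in probability, that keeps the martingale property
and makes a given random variable integrable. -/
theorem exists_density_integrable_at (hP : Martingale P ℱ μ) (s : ℕ) {ζ : Ω → ℝ}
    (hζ : Measurable[ℱ s] ζ) {ε : ℝ} (hε : 0 < ε) :
    ∃ Λ : ℕ → Ω → ℝ, Adapted ℱ Λ ∧ (∀ u ω, 0 < Λ u ω) ∧ (∀ u ω, Λ u ω ≤ 1) ∧
      Martingale (fun u ω => Λ u ω • P u ω) ℱ μ ∧ (∀ u, s ≤ u → Λ u = Λ s) ∧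
      μ {ω | ∃ u, Λ u ω < Real.exp (-ε)} ≤ ENNReal.ofReal ε ∧
      Integrable (fun ω => Λ s ω * ζ ω) μ := by
  -- At time 0 a truncating factor is known from the start, so a density constant in time suffices.
  -- In the step, `ζ` is exchanged for its bound `G`, known one period earlier, and half of `ε` is
  -- spent on each density.
  induction s generalizing ζ ε with
  | zero =>
    obtain ⟨M, hM⟩ := exists_nat_measure_lt_abs_le (μ := μ) (hζ.mono (ℱ.le 0) le_rfl) hε
    have hM0 : (0 : ℝ) < (M : ℝ) + 1 := by positivity
    let φ : Ω → ℝ := fun ω => (max 1 (|ζ ω| / ((M : ℝ) + 1)))⁻¹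
    have hφm : Measurable[ℱ 0] φ :=
      Measurable.comp (g := fun t : ℝ => (max 1 (|t| / ((M : ℝ) + 1)))⁻¹)
        (measurable_const.max (measurable_id.abs.div_const _)).inv hζ
    have hφ0 : ∀ ω, 0 < φ ω := fun ω =>
      inv_pos.2 (lt_of_lt_of_le one_pos (le_max_left _ _))
    have hφ1 : ∀ ω, φ ω ≤ 1 := fun ω => inv_le_one_of_one_le₀ (le_max_left _ _)
    have hφu : ∀ u, Measurable[ℱ u] φ := fun u => hφm.mono (ℱ.mono u.zero_le) le_rfl
    refine ⟨fun _ => φ, hφu, fun _ => hφ0, fun _ => hφ1, ?_, fun _ _ => rfl, ?_, ?_⟩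
    · exact martingale_smul_of_forall_condExp_succ hP hφu (fun _ => hφ0) (fun _ => ⟨1, hφ1⟩)
        fun u => condExp_smul_martingale_succ hP (hφu u) hφ0 hφ1
    · refine (measure_mono fun ω hω => ?_).trans hM
      obtain ⟨_, hω⟩ := hω
      by_contra hcon
      have h1 : |ζ ω| ≤ M := not_lt.1 hcon
      have h2 : φ ω = 1 := by
        simp only [φ]
        rw [max_eq_left, inv_one]
        rw [div_le_one hM0]
        linarith
      change φ ω < _ at hω
      rw [h2] at hω
      linarith [Real.exp_lt_one_iff.2 (neg_lt_zero.2 hε)]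
    · refine (integrable_const ((M : ℝ) + 1)).mono'
        ((hφm.mul hζ).mono (ℱ.le 0) le_rfl).aestronglyMeasurable (.of_forall fun ω => ?_)
      rw [norm_mul, Real.norm_of_nonneg (hφ0 ω).le, Real.norm_eq_abs]
      simp only [φ]
      rw [inv_mul_le_iff₀ (lt_of_lt_of_le one_pos (le_max_left _ _)), ← div_le_iff₀ hM0]
      exact le_max_right _ _
  | succ s ih =>
    obtain ⟨c, φ, G, hc0, hc1, hφm, hφ0, hφ1, hG, hφG, hφP, hφμ⟩ :=
      exists_measurable_perturbation_same_condExp (ℱ.mono s.le_succ) (ℱ.le (s + 1))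
        (hP.1 (s + 1)).measurable (hP.integrable (s + 1)) hζ (half_pos hε)
    obtain ⟨Λ, hΛ, hΛ0, hΛ1, hΛP, hΛs, hΛμ, hΛi⟩ := ih hG (half_pos hε)
    have hcpos : 0 < c := (Real.exp_pos _).trans_le hc0
    have hφP' : μ[fun ω => φ ω • P (s + 1) ω | ℱ s] =ᵐ[μ] fun ω => c • P s ω := by
      refine hφP.trans ?_
      filter_upwards [hP.2 s (s + 1) s.le_succ] with ω hω
      simp [hω]
    obtain ⟨hA, hM⟩ := martingale_splice hP hΛ hΛ0 hΛ1 hΛP s hcpos hφm hφ0 hφ1 hφP'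
    refine ⟨_, hA, fun u ω => ?_, fun u ω => ?_, hM, fun u hu => ?_, ?_, ?_⟩
    · split_ifs
      · exact mul_pos hcpos (hΛ0 u ω)
      · exact mul_pos (hΛ0 s ω) (hφ0 ω)
    · split_ifs
      · exact mul_le_one₀ hc1 (hΛ0 u ω).le (hΛ1 u ω)
      · exact mul_le_one₀ (hΛ1 s ω) (hφ0 ω).le (hφ1 ω)
    · have h1 : ¬ u ≤ s := by omega
      have h2 : ¬ s + 1 ≤ s := by omega
      simp only [h1, h2, if_false]
    · have hexp : Real.exp (-ε) = Real.exp (-(ε / 2)) * Real.exp (-(ε / 2)) := by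
        rw [← Real.exp_add]
        ring_nf
      have hsub : {ω | ∃ u, (if u ≤ s then c * Λ u ω else Λ s ω * φ ω) < Real.exp (-ε)} ⊆
          {ω | ∃ u, Λ u ω < Real.exp (-(ε / 2))} ∪ {ω | φ ω < Real.exp (-(ε / 2))} := by
        rintro ω ⟨u, hu⟩
        by_contra hcon
        simp only [Set.mem_union, Set.mem_ofPred_eq, not_or, not_exists, not_lt] at hcon
        obtain ⟨h1, h2⟩ := hcon
        refine absurd hu (not_lt.2 ?_)
        rw [hexp]
        split_ifs
        · exact mul_le_mul hc0 (h1 u) (Real.exp_pos _).le hcpos.le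
        · exact mul_le_mul (h1 s) h2 (Real.exp_pos _).le (hΛ0 s ω).le
      refine (measure_mono hsub).trans ((measure_union_le _ _).trans ?_)
      refine (add_le_add hΛμ hφμ).trans ?_
      rw [← ENNReal.ofReal_add (half_pos hε).le (half_pos hε).le, add_halves]
    · have h2 : ¬ s + 1 ≤ s := by omega
      simp only [h2, if_false]
      refine hΛi.mono ?_ (.of_forall fun ω => ?_)
      · exact ((((hΛ s).mono (ℱ.le s) le_rfl).mul (hφm.mono (ℱ.le _) le_rfl)).mul
          (hζ.mono (ℱ.le _) le_rfl)).aestronglyMeasurable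
      · rw [norm_mul, norm_mul, norm_mul, mul_assoc]
        refine mul_le_mul_of_nonneg_left ?_ (norm_nonneg _)
        rw [Real.norm_of_nonneg (hφ0 ω).le, Real.norm_eq_abs (ζ ω)]
        exact (hφG ω).trans (le_abs_self _)

end DensityProcess

open Filter Topology in
/-- A decreasing sequence of densities whose consecutive ratios are close to one in probability
has an almost surely positive limit. -/
lemma ae_forall_pos_of_tendsto_of_measure_le {Ω : Type*} {mΩ : MeasurableSpace Ω} {μ : Measure Ω}
    {Y : ℕ → ℕ → Ω → ℝ} {Z : ℕ → Ω → ℝ}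
    (hY0 : ∀ s u ω, 0 < Y s u ω) (hZ : ∀ u ω, Tendsto (fun s => Y s u ω) atTop (𝓝 (Z u ω)))
    (hμ : ∀ s : ℕ, μ {ω | ∃ u, Y (s + 1) u ω < Real.exp (-(1 / 2 : ℝ) ^ s) * Y s u ω} ≤
      ENNReal.ofReal ((1 / 2 : ℝ) ^ s)) :
    ∀ᵐ ω ∂μ, ∀ u, 0 < Z u ω := by
  have hsum : ∑' s, μ {ω | ∃ u, Y (s + 1) u ω < Real.exp (-(1 / 2 : ℝ) ^ s) * Y s u ω} ≠ ⊤ := by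
    refine ne_top_of_le_ne_top ?_ (ENNReal.tsum_le_tsum hμ)
    rw [← ENNReal.ofReal_tsum_of_nonneg (fun s => by positivity) summable_geometric_two]
    exact ENNReal.ofReal_ne_top
  filter_upwards [ae_eventually_notMem hsum] with ω hω u
  obtain ⟨S, hS⟩ := eventually_atTop.1 hω
  have hstep : ∀ s, S ≤ s → Real.exp (-(1 / 2 : ℝ) ^ s) * Y s u ω ≤ Y (s + 1) u ω := by
    intro s hs
    have := hS s hs
    simp only [not_exists, not_lt] at this
    exact this u
  -- The exponent is minus the geometric sum of $2^{-s}$ over $S\le s<S+k$, so the accumulated loss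
  -- stays bounded. Borel–Cantelli provides `S`.
  have hlow : ∀ k, Real.exp (-2 * (1 / 2 : ℝ) ^ S + 2 * (1 / 2 : ℝ) ^ (S + k)) * Y S u ω ≤
      Y (S + k) u ω := by
    intro k
    induction k with
    | zero => simp
    | succ k ih =>
      refine le_trans (le_of_eq ?_) ((mul_le_mul_of_nonneg_left ih (Real.exp_pos _).le).trans
        (hstep (S + k) (Nat.le_add_right S k)))
      rw [← mul_assoc, ← Real.exp_add, ← add_assoc S k 1, pow_succ _ (S + k)]
      ring_nf
  have hlow' : ∀ k, Real.exp (-2 * (1 / 2 : ℝ) ^ S) * Y S u ω ≤ Y (k + S) u ω := by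
    intro k
    rw [add_comm]
    refine le_trans (mul_le_mul_of_nonneg_right ?_ (hY0 S u ω).le) (hlow k)
    refine Real.exp_le_exp.2 ?_
    have : (0 : ℝ) ≤ (1 / 2 : ℝ) ^ (S + k) := by positivity
    linarith
  exact (mul_pos (Real.exp_pos _) (hY0 S u ω)).trans_le
    (ge_of_tendsto' ((tendsto_add_atTop_iff_nat S).2 (hZ u ω)) hlow')

section DensityProcess

variable {Ω : Type*} {mΩ : MeasurableSpace Ω} {μ : Measure Ω} [IsProbabilityMeasure μ]
  {ℱ : Filtration ℕ mΩ}
  {E : Type*} [NormedAddCommGroup E] [InnerProductSpace ℝ E] [FiniteDimensional ℝ E]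
  {P : ℕ → Ω → E}
  [MeasurableSpace E] [BorelSpace E]

open Filter Topology in
/-- A martingale admits a density process that keeps the martingale property and makes all the
terms of a given adapted process integrable. -/
theorem exists_density_forall_integrable (hP : Martingale P ℱ μ) {ζ : ℕ → Ω → ℝ}
    (hζ : Adapted ℱ ζ) :
    ∃ Z : ℕ → Ω → ℝ, Adapted ℱ Z ∧ (∀ᵐ ω ∂μ, ∀ u, 0 < Z u ω) ∧
      Martingale (fun u ω => Z u ω • P u ω) ℱ μ ∧ ∀ u, Integrable (fun ω => Z u ω * ζ u ω) μ := by
  let D := {Y : ℕ → Ω → ℝ // Adapted ℱ Y ∧ (∀ u ω, 0 < Y u ω) ∧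
    Martingale (fun u ω => Y u ω • P u ω) ℱ μ}
  have hstep : ∀ (s : ℕ) (Y : D), ∃ Y' : D, (∀ u ω, Y'.1 u ω ≤ Y.1 u ω) ∧
      μ {ω | ∃ u, Y'.1 u ω < Real.exp (-(1 / 2 : ℝ) ^ s) * Y.1 u ω} ≤
        ENNReal.ofReal ((1 / 2 : ℝ) ^ s) ∧
      Integrable (fun ω => Y'.1 s ω * ζ s ω) μ := by
    rintro s ⟨Y, hY, hY0, hYP⟩
    -- The next density is built relative to the martingale $YP$ and the variable $Y_s\zeta_s$, so
    -- that the product $\Lambda Y$ makes $\zeta_s$ integrable.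
    obtain ⟨Λ, hΛ, hΛ0, hΛ1, hΛP, -, hΛμ, hΛi⟩ := exists_density_integrable_at hYP s
      ((hY s).mul (hζ s)) (show (0 : ℝ) < (1 / 2 : ℝ) ^ s by positivity)
    refine ⟨⟨fun u ω => Λ u ω * Y u ω, fun u => (hΛ u).mul (hY u),
      fun u ω => mul_pos (hΛ0 u ω) (hY0 u ω), by simpa only [mul_smul] using hΛP⟩,
      fun u ω => mul_le_of_le_one_left (hY0 u ω).le (hΛ1 u ω), ?_, ?_⟩
    · simpa only [mul_lt_mul_iff_left₀ (hY0 _ _)] using hΛμ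
    · simpa only [Pi.mul_apply, mul_assoc] using hΛi
  choose next hle hnextμ hnexti using hstep
  let Y₀ : D := ⟨fun _ _ => 1, fun _ => measurable_const, fun _ _ => one_pos, by simpa using hP⟩
  let Y : ℕ → D := fun s => Nat.rec Y₀ (fun s Y => next s Y) s
  have hanti : ∀ u ω, Antitone fun s => (Y s).1 u ω := fun u ω =>
    antitone_nat_of_succ_le fun s => hle s (Y s) u ω
  have hlim : ∀ u ω, ∃ z, Tendsto (fun s => (Y s).1 u ω) atTop (𝓝 z) := fun u ω =>
    ⟨_, tendsto_atTop_ciInf (hanti u ω) ⟨0, by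
      rintro _ ⟨s, rfl⟩
      exact ((Y s).2.2.1 u ω).le⟩⟩
  choose Z hZ using hlim
  have hZ0 : ∀ u ω, 0 ≤ Z u ω := fun u ω =>
    ge_of_tendsto' (hZ u ω) fun s => ((Y s).2.2.1 u ω).le
  have hZY : ∀ s u ω, Z u ω ≤ (Y s).1 u ω := fun s u ω => (hanti u ω).le_of_tendsto (hZ u ω) s
  have hZm : Adapted ℱ Z := fun u =>
    @measurable_of_tendsto_metrizable Ω ℝ (ℱ u) _ _ _ _ _ _ (fun s => (Y s).2.1 u)
      (tendsto_pi_nhds.2 (hZ u))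
  have hYi : ∀ s u, Integrable (fun ω => (Y s).1 u ω • P u ω) μ := fun s u =>
    (Y s).2.2.2.integrable u
  have hbound : ∀ s u ω, ‖(Y s).1 u ω • P u ω‖ ≤ ‖P u ω‖ := by
    intro s u ω
    rw [norm_smul, Real.norm_of_nonneg ((Y s).2.2.1 u ω).le]
    exact mul_le_of_le_one_left (norm_nonneg _) (hanti u ω s.zero_le)
  have hZi : ∀ u, Integrable (fun ω => Z u ω • P u ω) μ := by
    intro u
    refine (hP.integrable u).mono (((hZm u).mono (ℱ.le u) le_rfl).aestronglyMeasurable.smul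
      (hP.integrable u).aestronglyMeasurable) (.of_forall fun ω => ?_)
    rw [norm_smul, Real.norm_of_nonneg (hZ0 u ω)]
    exact mul_le_of_le_one_left (norm_nonneg _) (hZY 0 u ω)
  refine ⟨Z, hZm, ?_, ?_, fun t => ?_⟩
  · exact ae_forall_pos_of_tendsto_of_measure_le (Y := fun s => (Y s).1) (fun s => (Y s).2.2.1) hZ
      fun s => hnextμ s (Y s)
  · refine martingale_nat (fun u => (hZm u).stronglyMeasurable.smul (hP.1 u)) hZi fun u => ?_
    have h1 : μ[fun ω => Z (u + 1) ω • P (u + 1) ω | ℱ u] =ᵐ[μ] μ[fun ω => Z u ω • P u ω | ℱ u] := by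
      -- The densities decrease from 1, so $\|P\|$ dominates and the martingale identity survives
      -- the limit.
      refine tendsto_condExp_unique (fun s ω => (Y s).1 (u + 1) ω • P (u + 1) ω)
        (fun s ω => (Y s).1 u ω • P u ω) _ _ (fun s => hYi s _) (fun s => hYi s _)
        (.of_forall fun ω => (hZ _ ω).smul_const _) (.of_forall fun ω => (hZ _ ω).smul_const _)
        _ (hP.integrable (u + 1)).norm _ (hP.integrable u).norm
        (fun s => .of_forall fun ω => hbound s _ ω) (fun s => .of_forall fun ω => hbound s _ ω)
        fun s => ?_
      exact ((Y s).2.2.2.2 u (u + 1) u.le_succ).trans ((Y s).2.2.2.2 u u le_rfl).symm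
    have h2 : μ[fun ω => Z u ω • P u ω | ℱ u] = fun ω => Z u ω • P u ω :=
      condExp_of_stronglyMeasurable (ℱ.le u) ((hZm u).stronglyMeasurable.smul (hP.1 u)) (hZi u)
    rw [h2] at h1
    exact h1.symm
  -- Stage `t` produces `Y (t + 1)`, which integrates $\zeta_t$; the limit lies below it.
  · refine (hnexti t (Y t)).mono ((((hZm t).mul (hζ t)).mono (ℱ.le t) le_rfl).aestronglyMeasurable)
      (.of_forall fun ω => ?_)
    rw [norm_mul, norm_mul, Real.norm_of_nonneg (hZ0 t ω),
      Real.norm_of_nonneg ((next t (Y t)).2.2.1 t ω).le]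
    exact mul_le_mul_of_nonneg_right (hZY (t + 1) t ω) (norm_nonneg _)

end DensityProcess

/-! ### Deflators and assembly of the strategy. -/

section Market

variable {Ω : Type*} {mΩ : MeasurableSpace Ω} {ℙ : Measure Ω} [IsProbabilityMeasure ℙ]
  {ℱ : Filtration ℕ mΩ} {n : ℕ} {P : ℕ → Ω → EuclideanSpace ℝ (Fin n)}

/-- If there is a martingale deflator, then there is one that makes a given adapted process
integrable at all times. -/
theorem exists_isMartingaleDeflator_forall_integrable (hdefl : ∃ Y, IsMartingaleDeflator ℙ ℱ P Y)
    {ξ : ℕ → Ω → ℝ} (hξ : Adapted ℱ ξ) :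
    ∃ Z, IsMartingaleDeflator ℙ ℱ P Z ∧ ∀ t, Integrable (fun ω => ξ t ω * Z t ω) ℙ := by
  obtain ⟨Y, hY⟩ := hdefl
  obtain ⟨Z, hZ, hZ0, hZP, hZξ⟩ := exists_density_forall_integrable hY.martingale
    (ζ := fun t ω => ξ t ω * Y t ω) fun t => (hξ t).mul (hY.adapted t)
  refine ⟨fun t ω => Z t ω * Y t ω, ⟨fun t => (hZ t).mul (hY.adapted t), fun t => ?_, ?_⟩,
    fun t => ?_⟩
  · filter_upwards [hZ0, hY.pos t] with ω h1 h2
    exact mul_pos (h1 t) h2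
  · simpa only [mul_smul] using hZP
  · exact (hZξ t).congr (.of_forall fun ω => by ring)

/-- One-period superhedging in a market with a deflator `Z` making `ξ` integrable. -/
theorem exists_one_period_superhedge {Z : ℕ → Ω → ℝ} (hZ : IsMartingaleDeflator ℙ ℱ P Z)
    {ξ : ℕ → Ω → ℝ} (hξ : Adapted ℱ ξ) (hξZ : ∀ t, Integrable (fun ω => ξ t ω * Z t ω) ℙ)
    (hsuper : ∀ Y, IsMartingaleDeflator ℙ ℱ P Y →
      (∀ t, Integrable (fun ω => ξ t ω * Y t ω) ℙ) →
      Supermartingale (fun t ω => ξ t ω * Y t ω) ℱ ℙ) (t : ℕ) :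
    ∃ h : Ω → EuclideanSpace ℝ (Fin n), Measurable[ℱ t] h ∧
      ∀ᵐ ω ∂ℙ, inner ℝ (h ω) (P t ω) ≤ ξ t ω ∧ ξ (t + 1) ω ≤ inner ℝ (h ω) (P (t + 1) ω) := by
  have hM := hZ.martingale
  have hθ : ∀ θ : Ω → ℝ, Measurable[ℱ (t + 1)] θ → (∀ ω, 0 < θ ω) → (∃ C, ∀ ω, θ ω ≤ C) →
      ℙ[fun ω => θ ω • Z (t + 1) ω • P (t + 1) ω | ℱ t] =ᵐ[ℙ] (fun ω => Z t ω • P t ω) →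
      ℙ[fun ω => θ ω * (ξ (t + 1) ω * Z (t + 1) ω) | ℱ t] ≤ᵐ[ℙ] fun ω => ξ t ω * Z t ω := by
    intro θ hθ hθ0 hθC hθP
    obtain ⟨C, hC⟩ := hθC
    -- The new deflator equals $Z$ up to time $t$ and $\theta Z$ afterwards. Boundedness of $\theta$
    -- preserves the integrability of $\xi$ times the deflator.
    obtain ⟨hA, hY⟩ := martingale_splice hM (Λ := fun _ _ => 1) (fun _ => measurable_const)
      (fun _ _ => one_pos) (fun _ _ => le_rfl) (by simpa using hM) t one_pos hθ hθ0 hC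
      (by simpa using hθP)
    simp only [mul_one, one_mul] at hA hY
    have hYd : IsMartingaleDeflator ℙ ℱ P
        (fun u ω => (if u ≤ t then 1 else θ ω) * Z u ω) := by
      refine ⟨fun u => (hA u).mul (hZ.adapted u), fun u => ?_, by simpa only [mul_smul] using hY⟩
      filter_upwards [hZ.pos u] with ω hω
      refine mul_pos ?_ hω
      split_ifs
      · exact one_pos
      · exact hθ0 ω
    have hYi : ∀ u, Integrable
        (fun ω => ξ u ω * ((if u ≤ t then 1 else θ ω) * Z u ω)) ℙ := by
      intro u
      by_cases hu : u ≤ t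
      · simpa only [hu, if_true, one_mul] using hξZ u
      · simp only [hu, if_false]
        refine (integrable_smul_of_pos_of_le (hξZ u) (hθ.mono (ℱ.le _) le_rfl) hθ0 hC).congr
          (.of_forall fun ω => ?_)
        simp only [smul_eq_mul]
        ring
    have hS := (hsuper _ hYd hYi).2.1 t (t + 1) t.le_succ
    have ht : ¬ t + 1 ≤ t := by omega
    simp only [le_refl, ht, if_true, if_false, one_mul] at hS
    simpa only [mul_left_comm (ξ (t + 1) _)] using hS
  obtain ⟨h, hhm, hh⟩ := exists_measurable_superhedge_of_condExp_le (μ := ℙ)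
    (ℱ.mono t.le_succ) (ℱ.le (t + 1)) (hM.1 (t + 1)).measurable (hM.integrable (t + 1))
    ((hξ (t + 1)).mul (hZ.adapted (t + 1))) (hξZ (t + 1)) (hM.2 t (t + 1) t.le_succ)
    ((hξ t).mul (hZ.adapted t)) hθ
  refine ⟨h, hhm, ?_⟩
  -- Both inequalities are homogeneous in the deflator, which is cancelled by positivity.
  filter_upwards [hh, hZ.pos t, hZ.pos (t + 1)] with ω ⟨h1, h2⟩ h3 h4
  simp only [Pi.mul_apply, real_inner_smul_right] at h1 h2
  rw [mul_comm] at h1 h2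
  exact ⟨le_of_mul_le_mul_right h1 h3, le_of_mul_le_mul_left h2 h4⟩

end Market

theorem mainTheorem2 {Ω : Type*} {mΩ : MeasurableSpace Ω} (ℙ : Measure Ω) [IsProbabilityMeasure ℙ]
    (ℱ : Filtration ℕ mΩ) {n : ℕ} (P : ℕ → Ω → EuclideanSpace ℝ (Fin n)) (hP : Adapted ℱ P)
    (hdefl : ∃ Y, IsMartingaleDeflator ℙ ℱ P Y)
    (ξ : ℕ → Ω → ℝ) (hξ : Adapted ℱ ξ)
    (hsuper : ∀ Y, IsMartingaleDeflator ℙ ℱ P Y →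
      (∀ t, Integrable (fun ω => ξ t ω * Y t ω) ℙ) →
      Supermartingale (fun t ω => ξ t ω * Y t ω) ℱ ℙ) :
    ∃ H : ℕ → Ω → EuclideanSpace ℝ (Fin n),
      IsInvestmentConsumptionStrategy ℙ ℱ P H ∧
      (∀ᵐ ω ∂ℙ, inner ℝ (H 1 ω) (P 0 ω) ≤ ξ 0 ω) ∧
      ∀ t, 1 ≤ t → ∀ᵐ ω ∂ℙ,
        inner ℝ (H (t + 1) ω) (P t ω) ≤ ξ t ω ∧ ξ t ω ≤ inner ℝ (H t ω) (P t ω) := by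
  obtain ⟨Z, hZ, hξZ⟩ := exists_isMartingaleDeflator_forall_integrable hdefl hξ
  choose h hhm hh using exists_one_period_superhedge hZ hξ hξZ hsuper
  -- The portfolio `h t` is chosen at time `t` and held over the next period, hence the shift. At 0
  -- the truncated subtraction gives `h 0`, which is measurable at time 0 as predictability asks.
  let H : ℕ → Ω → EuclideanSpace ℝ (Fin n) := fun t => h (t - 1)
  have hH : ∀ t, 1 ≤ t → ∀ᵐ ω ∂ℙ,
      inner ℝ (H (t + 1) ω) (P t ω) ≤ ξ t ω ∧ ξ t ω ≤ inner ℝ (H t ω) (P t ω) := by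
    intro t ht
    obtain ⟨s, rfl⟩ : ∃ s, t = s + 1 := ⟨t - 1, by omega⟩
    filter_upwards [hh s, hh (s + 1)] with ω h1 h2
    exact ⟨h2.1, h1.2⟩
  refine ⟨H, ⟨?_, fun t ht => ?_⟩, ?_, hH⟩
  · exact IsStronglyPredictable.of_measurable_add_one (hhm 0).stronglyMeasurable
      fun t => (hhm t).stronglyMeasurable
  · filter_upwards [hH t ht] with ω hω
    exact hω.1.trans hω.2
  · filter_upwards [hh 0] with ω hω
    exact hω.1
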